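/- Let $\bar{\mathbb R}=\mathbb R\cup\{\pm\infty\}$ and order $\bar{\mathbb R}^2$ componentwise. For $a\in\mathbb R$ write $\vec a=(a,a)$, with $\pm\infty+a=\pm\infty$. An \emph{interval} is a nonempty set $I\subseteq\bar{\mathbb R}^2$ such that $p\le r\le q$ with $p,q\in I$ implies $r\in I$, and any two points $p,q\in I$ are joined by a path $p\le p_1\ge p_2\le\cdots\ge p_{2m}\le q$ in $I$. Its lower and upper boundaries $L(I)$ and $U(I)$ consist of the points $x$ of the closure $\bar I$ such that no $y$ with $y_i<x_i$ for all $i$ (respectively $y_i>x_i$ for all $i$) lies in $I$. The interval is \emph{discretely presented} if it is a finite union of rectangles $[a_1,b_1]\times[a_2,b_2]$ with $a_i<b_i$ in $\bar{\mathbb R}$ and $L(I)\cup U(I)$ is a topological $1$-manifold. Its edges are the sets $L(I)\cap\{x_i=c\}$ and $U(I)\cap\{x_i=c\}$ ($i\in\{1,2\}$, $c\in\bar{\mathbb R}$) with more than one point; these are horizontal or vertical segments, and $V(I)$ denotes the set of their end points (the vertices). The interval module over a field $\Bbbk$ with interval $I$ is $\Bbbk$ at the points of $I$ and $0$ elsewhere,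 with structure maps the identity between points of $I$ and $0$ otherwise. Persistence modules are functors from $\bar{\mathbb R}^2$ to vector spaces; $M$ and $N$ are $\delta$-interleaved ($\delta\ge0$) if there are linear maps $\phi_x\colon M_x\to N_{x+\vec\delta}$ and $\psi_x\colon N_x\to M_{x+\vec\delta}$ for all $x\in\bar{\mathbb R}^2$ that commute with the structure maps and satisfy $\psi_{x+\vec\delta}\circ\phi_x=\rho^M_{x\to x+2\vec\delta}$ and $\phi_{x+\vec\delta}\circ\psi_x=\rho^N_{x\to x+2\vec\delta}$; $d_I(M,N)\in[0,\infty]$ is the infimum of all such $\delta$ ($\infty$ if there is none). For $x\in\bar{\mathbb R}^2$ and $A\subseteq\bar{\mathbb R}^2$ let $\mathrm{dl}(x,A)$ be the infimum of $d_\infty(x,y)=\max_i|x_i-y_i|$ (with $|\infty-\infty|=|(-\infty)-(-\infty)|=0$) over the points $y\in A$ of the form $y=x+\vec a$, $a\in\mathbb R$, and $\infty$ if there is no such point. \textbf{Theorem.} Let $M$ and $N$ be $2$-parameter interval modules with discretely presented intervals $I_M$ and $I_N$. For a point $x$ put $$D(x)=\{\mathrm{dl}(x,L(I_M)),\ \mathrm{dl}(x,L(I_N)),\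 \mathrm{dl}(x,U(I_M)),\ \mathrm{dl}(x,U(I_N))\},$$ $$S=\{d\in[0,\infty]\mid d\in D(x)\text{ or }2d\in D(x)\text{ for some }x\in V(I_M)\cup V(I_N)\}.$$ Then $S$ is finite, with at most $8(|V(I_M)|+|V(I_N)|)$ elements, and $d_I(M,N)\in S$. -/

import Mathlib

open CategoryTheory
open scoped ENNReal NNReal

universe u

noncomputable section

namespace BiPersistence

/-- The enriched parameter poset: `n`-tuples of extended reals, with the product order and the
product topology. -/
abbrev Pt (n : ℕ) : Type := Fin n → EReal

/-- The diagonal translate `x + (a, …, a)`; infinite coordinates stay fixed. -/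
def translate {n : ℕ} (a : ℝ) (x : Pt n) : Pt n := fun i => x i + (a : EReal)

theorem translate_mono {n : ℕ} (a : ℝ) {x y : Pt n} (h : x ≤ y) :
    translate a x ≤ translate a y :=
  fun i => add_le_add (h i) le_rfl

theorem le_translate {n : ℕ} (δ : ℝ≥0) (x : Pt n) : x ≤ translate (δ : ℝ) x := fun _ =>
  le_add_of_nonneg_right (EReal.coe_nonneg.2 δ.2)

theorem le_translate_translate {n : ℕ} (δ : ℝ≥0) (x : Pt n) :
    x ≤ translate (δ : ℝ) (translate (δ : ℝ) x) :=
  (le_translate δ x).trans (le_translate δ _)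

/-! ### Persistence modules and the interleaving distance -/

/-- The parameter poset as a category: there is a unique arrow `x ⟶ y` if `x ≤ y`, and none
otherwise. (Declared here because instance search would otherwise find the product of `n` copies of
the category of the poset `EReal`.) -/
instance ptCategory (n : ℕ) : Category (Pt n) := Preorder.smallCategory (Pt n)

/-- An `n`-parameter persistence module: a functor from the parameter poset to vector spaces. -/
abbrev PersistenceModule (K : Type u) [Field K] (n : ℕ) : Type (u + 1) :=
  Pt n ⥤ ModuleCat.{u} K

/-- `M` and `N` are `δ`-interleaved: there are families of linear maps `φ x : M x → N (x + δ)` and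
`ψ x : N x → M (x + δ)` with triangular and square commutativity. -/
def Interleaved {K : Type u} [Field K] {n : ℕ} (M N : PersistenceModule K n) (δ : ℝ≥0) : Prop :=
  ∃ (φ : ∀ x : Pt n, M.obj x ⟶ N.obj (translate (δ : ℝ) x))
    (ψ : ∀ x : Pt n, N.obj x ⟶ M.obj (translate (δ : ℝ) x)),
    (∀ x, φ x ≫ ψ (translate (δ : ℝ) x) = M.map (homOfLE (le_translate_translate δ x))) ∧
    (∀ x, ψ x ≫ φ (translate (δ : ℝ) x) = N.map (homOfLE (le_translate_translate δ x))) ∧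
    (∀ (x y : Pt n) (h : x ≤ y),
      M.map (homOfLE h) ≫ φ y = φ x ≫ N.map (homOfLE (translate_mono (δ : ℝ) h))) ∧
    (∀ (x y : Pt n) (h : x ≤ y),
      N.map (homOfLE h) ≫ ψ y = ψ x ≫ M.map (homOfLE (translate_mono (δ : ℝ) h)))

/-- The interleaving distance, equal to `∞` if there is no interleaving at all. -/
def interleavingDistance {K : Type u} [Field K] {n : ℕ} (M N : PersistenceModule K n) : ℝ≥0∞ :=
  ⨅ (δ : ℝ≥0) (_ : Interleaved M N δ), (δ : ℝ≥0∞)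

/-! ### Intervals and interval modules -/

/-- Intervals: nonempty, order-convex, and any two points `p`, `q` are joined by a path
`p ≤ p₁ ≥ p₂ ≤ ⋯ ≥ p₂ₘ ≤ q` in `I` (here `s 0 = p` and `s (2 * m + 1) = q`). -/
structure IsInterval {n : ℕ} (I : Set (Pt n)) : Prop where
  nonempty : I.Nonempty
  convex : ∀ p ∈ I, ∀ q ∈ I, ∀ r, p ≤ r → r ≤ q → r ∈ I
  connected : ∀ p ∈ I, ∀ q ∈ I, ∃ (m : ℕ) (s : ℕ → Pt n),
    s 0 = p ∧ s (2 * m + 1) = q ∧ (∀ k ≤ 2 * m + 1, s k ∈ I) ∧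
    (∀ k ≤ 2 * m, (Even k → s k ≤ s (k + 1)) ∧ (Odd k → s (k + 1) ≤ s k))

open Classical in
/-- The vector space of the interval module at `x`: all of `K` if `x ∈ I`, and `0` otherwise. -/
def fiber (K : Type u) [Field K] {n : ℕ} (I : Set (Pt n)) (x : Pt n) : Submodule K K :=
  if x ∈ I then ⊤ else ⊥

theorem fiber_eq_zero {K : Type u} [Field K] {n : ℕ} {I : Set (Pt n)} {x : Pt n} (hx : x ∉ I)
    (v : fiber K I x) : (v : K) = 0 := by
  have h := v.2
  simpa [fiber, hx] using h

open Classical in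
/-- The structure map of the interval module: the identity of `K` if `x, y ∈ I`, and `0`
otherwise. -/
def fiberMap (K : Type u) [Field K] {n : ℕ} (I : Set (Pt n)) (x y : Pt n) :
    fiber K I x →ₗ[K] fiber K I y where
  toFun v := ⟨if x ∈ I ∧ y ∈ I then (v : K) else 0, by
    by_cases h : x ∈ I ∧ y ∈ I
    · simp [fiber, h.2]
    · simp [h]⟩
  map_add' v w := by
    ext
    by_cases h : x ∈ I ∧ y ∈ I <;> simp [h]
  map_smul' c v := by
    ext
    by_cases h : x ∈ I ∧ y ∈ I <;> simp [h]

/-- The interval module with interval `I`. -/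
def intervalModule (K : Type u) [Field K] {n : ℕ} (I : Set (Pt n)) (hI : IsInterval I) :
    PersistenceModule K n where
  obj x := ModuleCat.of K (fiber K I x)
  map {x y} _ := ModuleCat.ofHom (fiberMap K I x y)
  map_id x := by
    ext v
    by_cases h : x ∈ I
    · simp [fiberMap, h]
    · simp [fiberMap, h, fiber_eq_zero h v]
  map_comp {x y z} f g := by
    ext v
    by_cases hx : x ∈ I
    · by_cases hz : z ∈ I
      · have hy : y ∈ I := hI.convex x hx z hz y (leOfHom f) (leOfHom g)
        simp [fiberMap, hx, hy, hz]
      · simp [fiberMap, hz]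
    · simp [fiberMap, hx]

/-- The lower boundary `L(I)`. -/
def lowerBoundary {n : ℕ} (I : Set (Pt n)) : Set (Pt n) :=
  {x | x ∈ closure I ∧ ∀ y : Pt n, (∀ i, y i < x i) → y ∉ I}

/-- The upper boundary `U(I)`. -/
def upperBoundary {n : ℕ} (I : Set (Pt n)) : Set (Pt n) :=
  {x | x ∈ closure I ∧ ∀ y : Pt n, (∀ i, x i < y i) → y ∉ I}

/-- The boundary `B(I)`. -/
def boundary {n : ℕ} (I : Set (Pt n)) : Set (Pt n) := lowerBoundary I ∪ upperBoundary I

/-- A discretely presented interval: an interval that is a finite union of `n`-dimensional closed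
rectangles (with finite or infinite sides) and whose boundary is a topological
`(n - 1)`-manifold, i.e. locally homeomorphic to `ℝ ^ (n - 1)`. -/
structure IsDiscretelyPresented {n : ℕ} (I : Set (Pt n)) : Prop where
  isInterval : IsInterval I
  finite_union : ∃ R : Finset (Pt n × Pt n),
    (∀ r ∈ R, ∀ i, r.1 i < r.2 i) ∧ I = ⋃ r ∈ R, Set.Icc r.1 r.2
  manifold : Nonempty (ChartedSpace (EuclideanSpace ℝ (Fin (n - 1))) (boundary I))

/-! ### Edges, vertices, diagonal distances and the candidate set -/

/-- The edges of a `2`-parameter interval: the one-dimensional intersections of the lower or of the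
upper boundary with a vertical or horizontal line `{x | x i = c}`, where `c` may be infinite. -/
def edges (I : Set (Pt 2)) : Set (Set (Pt 2)) :=
  {e | e.Nontrivial ∧ ∃ F : Set (Pt 2), (F = lowerBoundary I ∨ F = upperBoundary I) ∧
    ∃ (i : Fin 2) (c : EReal), e = {x | x ∈ F ∧ x i = c}}

/-- The vertices: the end points of the edges. An edge is an axis-parallel segment, so that its end
points are its least and its greatest element. -/
def vertices (I : Set (Pt 2)) : Set (Pt 2) :=
  {v | ∃ e ∈ edges I, IsLeast e v ∨ IsGreatest e v}

/-- The diagonal line through `x`. -/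
def diagonal {n : ℕ} (x : Pt n) : Set (Pt n) := {y | ∃ a : ℝ, y = translate a x}

open Classical in
/-- The distance `d_∞(x, y) = max_i |x i - y i|`; equal infinite coordinates have distance `0`. -/
def distInf {n : ℕ} (x y : Pt n) : ℝ≥0∞ :=
  ⨆ i, if x i = y i then 0 else (x i - y i).abs

/-- The diagonal distance `dl(x, A)`, equal to `∞` if the diagonal through `x` misses `A`. -/
def dl {n : ℕ} (x : Pt n) (A : Set (Pt n)) : ℝ≥0∞ :=
  ⨅ y ∈ diagonal x ∩ A, distInf x y

/-- The set `D(x)` of diagonal distances from `x` to the four boundaries. -/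
def diagonalDistances (I J : Set (Pt 2)) (x : Pt 2) : Set ℝ≥0∞ :=
  {dl x (lowerBoundary I), dl x (lowerBoundary J), dl x (upperBoundary I), dl x (upperBoundary J)}

/-- The candidate set `S`. -/
def candidateSet (I J : Set (Pt 2)) : Set ℝ≥0∞ :=
  {d | ∃ x ∈ vertices I ∪ vertices J,
    d ∈ diagonalDistances I J x ∨ 2 * d ∈ diagonalDistances I J x}

end BiPersistence

end

noncomputable section

namespace BiPersistence

open Filter Topology

/-! ### Interleavings of interval modules in terms of supports -/

/-! The problem is read off diagonal by diagonal. On the diagonal with coordinate difference `t`, an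
interval is a bar from `l t` to `u t`. Since the interval is a finite union of rectangles, `l` and
`u` are staircases: on each side of each point they are locally constant or of slope `-1`.

For interleavings of interval modules only the places where the maps are nonzero matter. A
`δ`-interleaving exists as soon as the nonvanishing forced by the triangles and squares (`Reach`)
stays inside the region where it is allowed (`interleaved_of_reach`). In terms of bars, what can go
wrong is `Obstructed`: a bar of length at least `2δ` forces nonzero maps on its diagonal, and either
the ends of the two bars there are at least `δ` apart, or the nonvanishing spreads through
neighbouring diagonals with `u' - l ≥ δ` to one where the ends are badly placed. Absence of
obstructions at `δ` yields a `δ`-interleaving (`interleaved_of_not_obstructed`), and a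
`δ`-interleaving excludes obstructions at every larger parameter (`Interleaved.not_obstructed`).

An obstruction only compares differences of boundary functions with `δ`, or with `2δ` for the length
of a bar; this is the origin of the halves in the candidate set. Where two boundary curves run
parallel, their diagonal distance does not change along the edges, so sliding to the nearer end of
an edge exhibits it as the diagonal distance of a vertex (`IsCurve.dl_vertex_or_slope`). At every
other value the difference has slope `1` or `-1`, so one can climb to larger values. Hence an
obstruction at `δ` survives up to `δ'` if no candidate lies in `[δ, δ']` (`IsGeneric.obstructed`).

Suppose now that the distance `d` is not a candidate. If `0 < d < ∞`, choose `ε` with no candidate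
in `[d - ε, d + ε]`. There is no interleaving at `d - ε`, so there is an obstruction; it persists to
`d + ε` and contradicts the interleavings with parameter below `d + ε`. The value `0` is always a
candidate, because some vertex lies on a boundary. The value `∞` is one if an interval contains a
corner of the parameter square; otherwise zero maps interleave for large `δ`. -/

/-- The smallest set of points at which a `δ`-interleaving between the interval modules of `I` and
`J` is forced to have a nonzero component from `I` to `J`. -/
inductive Reach {n : ℕ} (I J : Set (Pt n)) (δ : ℝ) : Pt n → Prop
  | source (x : Pt n) (hx : x ∈ I) (hx' : translate δ (translate δ x) ∈ I) : Reach I J δ x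
  | target (x : Pt n) (hx : x ∈ J) (hx' : translate δ (translate δ x) ∈ J) :
      Reach I J δ (translate δ x)
  | up (x y : Pt n) (h : x ≤ y) (hr : Reach I J δ x) (hx : x ∈ I) (hy : translate δ y ∈ J) :
      Reach I J δ y
  | down (x y : Pt n) (h : y ≤ x) (hr : Reach I J δ x) (hy : y ∈ I) (hx : translate δ x ∈ J) :
      Reach I J δ y

open Classical in
/-- The map between two fibers which is the identity of `K` if `P` holds and `0` otherwise. -/
def fiberIf (K : Type u) [Field K] {n : ℕ} (I J : Set (Pt n)) (x y : Pt n) (P : Prop)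
    (hP : P → y ∈ J) : fiber K I x →ₗ[K] fiber K J y where
  toFun v := ⟨if P then (v : K) else 0, by
    by_cases h : P
    · simp [fiber, hP h]
    · simp [h]⟩
  map_add' v w := by
    ext
    by_cases h : P <;> simp [h]
  map_smul' c v := by
    ext
    by_cases h : P <;> simp [h]

open Classical in
theorem coe_fiberIf (K : Type u) [Field K] {n : ℕ} (I J : Set (Pt n)) (x y : Pt n) (P : Prop)
    (hP : P → y ∈ J) (v : fiber K I x) :
    (fiberIf K I J x y P hP v : K) = if P then (v : K) else 0 := rfl

open Classical in
theorem coe_fiberMap (K : Type u) [Field K] {n : ℕ} (I : Set (Pt n)) (x y : Pt n)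
    (v : fiber K I x) : (fiberMap K I x y v : K) = if x ∈ I ∧ y ∈ I then (v : K) else 0 := by
  by_cases h : x ∈ I ∧ y ∈ I <;> simp [fiberMap, h]

/-- Take the scalar `1` on the forced set and `0` elsewhere. The constructors of `Reach` are the
closure conditions under which triangles and squares commute, and `h₁`, `h₂` say that nothing is
forced where a fiber is zero. -/
theorem interleaved_of_reach (K : Type u) [Field K] {n : ℕ} {I J : Set (Pt n)}
    (hI : IsInterval I) (hJ : IsInterval J) (δ : ℝ≥0)
    (h₁ : ∀ x, Reach I J δ x → x ∈ I ∧ translate δ x ∈ J)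
    (h₂ : ∀ x, Reach J I δ x → x ∈ J ∧ translate δ x ∈ I) :
    Interleaved (intervalModule K I hI) (intervalModule K J hJ) δ := by
  classical
  refine ⟨fun x => ModuleCat.ofHom (fiberIf K I J x _ (Reach I J δ x) fun h => (h₁ x h).2),
    fun x => ModuleCat.ofHom (fiberIf K J I x _ (Reach J I δ x) fun h => (h₂ x h).2),
    ?_, ?_, ?_, ?_⟩
  · intro x
    refine ModuleCat.hom_ext (LinearMap.ext fun (v : fiber K I x) => Subtype.ext ?_)
    change (fiberIf K J I (translate δ x) (translate δ (translate δ x)) _ (fun h => (h₂ _ h).2)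
      (fiberIf K I J (x) (translate δ x) _ (fun h => (h₁ _ h).2) (v)) : K) = fiberMap K I (x)
      (translate δ (translate δ x)) (v)
    simp only [coe_fiberIf, coe_fiberMap]
    by_cases hx : x ∈ I
    · by_cases hx' : translate δ (translate δ x) ∈ I
      · have a := Reach.source (J := J) x hx hx'
        have b := Reach.target (I := J) x hx hx'
        simp [hx, hx', a, b]
      · have b : ¬ Reach J I δ (translate δ x) := fun h => hx' (h₂ _ h).2
        simp [hx', b]
    · simp [fiber_eq_zero hx v]
  · intro x
    refine ModuleCat.hom_ext (LinearMap.ext fun (v : fiber K J x) => Subtype.ext ?_)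
    change (fiberIf K I J (translate δ x) (translate δ (translate δ x)) _ (fun h => (h₁ _ h).2)
      (fiberIf K J I (x) (translate δ x) _ (fun h => (h₂ _ h).2) (v)) : K) = fiberMap K J (x)
      (translate δ (translate δ x)) (v)
    simp only [coe_fiberIf, coe_fiberMap]
    by_cases hx : x ∈ J
    · by_cases hx' : translate δ (translate δ x) ∈ J
      · have a := Reach.source (J := I) x hx hx'
        have b := Reach.target (I := I) x hx hx'
        simp [hx, hx', a, b]
      · have b : ¬ Reach I J δ (translate δ x) := fun h => hx' (h₁ _ h).2
        simp [hx', b]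
    · simp [fiber_eq_zero hx v]
  · intro x y h
    refine ModuleCat.hom_ext (LinearMap.ext fun (v : fiber K I x) => Subtype.ext ?_)
    change (fiberIf K I J (y) (translate δ y) _ (fun h => (h₁ _ h).2) (fiberMap K I (x) (y) (v)) :
      K) = fiberMap K J (translate δ x) (translate δ y) (fiberIf K I J (x) (translate δ x) _ (fun h
      => (h₁ _ h).2) (v))
    simp only [coe_fiberIf, coe_fiberMap]
    by_cases hx : x ∈ I
    · by_cases hy : translate δ y ∈ J
      · by_cases hr : Reach I J δ x
        · have hr' := Reach.up x y h hr hx hy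
          simp [hx, hy, hr, hr', h₁ _ hr, h₁ _ hr']
        · have hr' : ¬ Reach I J δ y := fun h' => hr (Reach.down y x h h' hx hy)
          simp [hr, hr']
      · have hr' : ¬ Reach I J δ y := fun h' => hy (h₁ _ h').2
        simp [hy, hr']
    · simp [fiber_eq_zero hx v]
  · intro x y h
    refine ModuleCat.hom_ext (LinearMap.ext fun (v : fiber K J x) => Subtype.ext ?_)
    change (fiberIf K J I (y) (translate δ y) _ (fun h => (h₂ _ h).2) (fiberMap K J (x) (y) (v)) :
      K) = fiberMap K I (translate δ x) (translate δ y) (fiberIf K J I (x) (translate δ x) _ (fun h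
      => (h₂ _ h).2) (v))
    simp only [coe_fiberIf, coe_fiberMap]
    by_cases hx : x ∈ J
    · by_cases hy : translate δ y ∈ I
      · by_cases hr : Reach J I δ x
        · have hr' := Reach.up x y h hr hx hy
          simp [hx, hy, hr, hr', h₂ _ hr, h₂ _ hr']
        · have hr' : ¬ Reach J I δ y := fun h' => hr (Reach.down y x h h' hx hy)
          simp [hr, hr']
      · have hr' : ¬ Reach J I δ y := fun h' => hy (h₂ _ h').2
        simp [hy, hr']
    · simp [fiber_eq_zero hx v]

/-- `w` is the nonvanishing locus of some morphism from the interval module of `I` to the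
`δ`-shift of the interval module of `J`. -/
structure IsSupport {n : ℕ} (I J : Set (Pt n)) (δ : ℝ) (w : Pt n → Prop) : Prop where
  mem : ∀ x, w x → x ∈ I ∧ translate δ x ∈ J
  iff : ∀ x y, x ≤ y → x ∈ I → translate δ y ∈ J → (w x ↔ w y)

/-- An element of a fiber of an interval module, as a scalar. -/
def coeff {K : Type u} [Field K] {n : ℕ} {I : Set (Pt n)} (hI : IsInterval I) {x : Pt n}
    (v : (intervalModule K I hI).obj x) : K := (show fiber K I x from v).1

/-- If `x ∈ I` and the shift of `y` is in `J`, a vector surviving one way around the naturality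
square survives the other way too; convexity of the intervals is not needed for this. -/
theorem isSupport_of_natural (K : Type u) [Field K] {n : ℕ} {I J : Set (Pt n)}
    (hI : IsInterval I) (hJ : IsInterval J) (δ : ℝ≥0)
    (φ : ∀ x : Pt n, (intervalModule K I hI).obj x ⟶
      (intervalModule K J hJ).obj (translate (δ : ℝ) x))
    (hφ : ∀ (x y : Pt n) (h : x ≤ y), (intervalModule K I hI).map (homOfLE h) ≫ φ y =
      φ x ≫ (intervalModule K J hJ).map (homOfLE (translate_mono (δ : ℝ) h))) :
    IsSupport I J δ (fun x => ∃ v : fiber K I x,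
      coeff hJ ((φ x).hom v) ≠ 0) where
  mem x := by
    rintro ⟨v, hv⟩
    constructor
    · by_contra hx
      have : v = 0 := Subtype.ext (fiber_eq_zero hx v)
      subst this
      apply hv
      rw [show (φ x).hom (0 : fiber K I x) = 0 from map_zero _]
      rfl
    · by_contra hx
      exact hv (fiber_eq_zero hx _)
  iff x y h hx hy := by
    have key : ∀ v : fiber K I x, coeff hJ ((φ y).hom (fiberMap K I x y v)) =
        (fiberMap K J (translate δ x) (translate δ y) ((φ x).hom v) : K) := by
      intro v
      have := congrArg (fun f => (f.hom v : fiber K J (translate δ y))) (hφ x y h)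
      exact congrArg (coeff hJ) this
    constructor
    · rintro ⟨v, hv⟩
      refine ⟨fiberMap K I x y v, ?_⟩
      rw [key]
      have hx' : translate δ x ∈ J := by
        by_contra hx'
        exact hv (fiber_eq_zero hx' _)
      exact fun h0 => hv (((coe_fiberMap K J _ _ _).trans (if_pos ⟨hx', hy⟩)).symm.trans h0)
    · rintro ⟨v, hv⟩
      have hyI : y ∈ I := by
        by_contra hx
        have : v = 0 := Subtype.ext (fiber_eq_zero hx v)
        subst this
        apply hv
        rw [show (φ y).hom (0 : fiber K I y) = 0 from map_zero _]
        rfl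
      refine ⟨⟨v, by simp [fiber, hx]⟩, fun h0 => hv ?_⟩
      have := key ⟨v, by simp [fiber, hx]⟩
      have e : fiberMap K I x y ⟨v, by simp [fiber, hx]⟩ = v := by
        ext
        simp [fiberMap, hx, hyI]
      rw [e] at this
      rw [this]
      have e' : (φ x).hom (⟨v, by simp [fiber, hx]⟩ : fiber K I x) =
          (0 : fiber K J (translate δ x)) := Subtype.ext h0
      rw [e', map_zero]
      rfl

/-- Where a point and its `2δ`-shift lie in the same interval, the composite sends `1` to `1`, so
neither factor vanishes. -/
theorem Interleaved.exists_isSupport {K : Type u} [Field K] {n : ℕ} {I J : Set (Pt n)}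
    {hI : IsInterval I} {hJ : IsInterval J} {δ : ℝ≥0}
    (h : Interleaved (intervalModule K I hI) (intervalModule K J hJ) δ) :
    ∃ w w' : Pt n → Prop, IsSupport I J δ w ∧ IsSupport J I δ w' ∧
      (∀ x ∈ I, translate δ (translate δ x) ∈ I → w x ∧ w' (translate δ x)) ∧
      (∀ x ∈ J, translate δ (translate δ x) ∈ J → w' x ∧ w (translate δ x)) := by
  obtain ⟨φ, ψ, h₁, h₂, h₃, h₄⟩ := h
  refine ⟨_, _, isSupport_of_natural K hI hJ δ φ h₃, isSupport_of_natural K hJ hI δ ψ h₄, ?_, ?_⟩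
  · intro x hx hx'
    have e := congrArg (fun f => (f.hom (⟨1, by simp [fiber, hx]⟩ : fiber K I x) :
      fiber K I (translate δ (translate δ x)))) (h₁ x)
    have e' : coeff hI ((ψ (translate δ x)).hom
        ((φ x).hom (⟨1, by simp [fiber, hx]⟩ : fiber K I x))) = 1 := by
      refine (congrArg (coeff hI) e).trans ?_
      change (fiberMap K I x (translate δ (translate δ x)) _ : K) = 1
      simp [coe_fiberMap, hx, hx']
    refine ⟨⟨⟨1, by simp [fiber, hx]⟩, fun h0 => ?_⟩, ⟨(φ x).hom (⟨1, by simp [fiber, hx]⟩ : fiber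
      K I x), fun h0 => ?_⟩⟩
    · have h0' : (φ x).hom (⟨1, by simp [fiber, hx]⟩ : fiber K I x) =
          (0 : fiber K J (translate δ x)) := Subtype.ext h0
      rw [h0', show (ψ (translate δ x)).hom (0 : fiber K J (translate δ x)) = 0 from map_zero _]
        at e'
      exact zero_ne_one e'
    · rw [e'] at h0
      exact one_ne_zero h0
  · intro x hx hx'
    have e := congrArg (fun f => (f.hom (⟨1, by simp [fiber, hx]⟩ : fiber K J x) :
      fiber K J (translate δ (translate δ x)))) (h₂ x)
    have e' : coeff hJ ((φ (translate δ x)).hom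
        ((ψ x).hom (⟨1, by simp [fiber, hx]⟩ : fiber K J x))) = 1 := by
      refine (congrArg (coeff hJ) e).trans ?_
      change (fiberMap K J x (translate δ (translate δ x)) _ : K) = 1
      simp [coe_fiberMap, hx, hx']
    refine ⟨⟨⟨1, by simp [fiber, hx]⟩, fun h0 => ?_⟩, ⟨(ψ x).hom (⟨1, by simp [fiber, hx]⟩ : fiber
      K J x), fun h0 => ?_⟩⟩
    · have h0' : (ψ x).hom (⟨1, by simp [fiber, hx]⟩ : fiber K J x) =
          (0 : fiber K I (translate δ x)) := Subtype.ext h0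
      rw [h0', show (φ (translate δ x)).hom (0 : fiber K I (translate δ x)) = 0 from map_zero _]
        at e'
      exact zero_ne_one e'
    · rw [e'] at h0
      exact one_ne_zero h0

/-! ### Staircase functions -/

/-- Continuous functions of a real variable which near each point, on each side, are constant or
have slope `-1`. -/
structure IsStair (p : ℝ → EReal) : Prop where
  cont : Continuous p
  anti : Antitone p
  lip : ∀ s t, s ≤ t → p s ≤ p t + ((t - s : ℝ) : EReal)
  right : ∀ t, (∀ᶠ s in 𝓝[>] t, p s = p t) ∨
    (∀ᶠ s in 𝓝[>] t, p s = p t + ((t - s : ℝ) : EReal))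
  left : ∀ t, (∀ᶠ s in 𝓝[<] t, p s = p t) ∨
    (∀ᶠ s in 𝓝[<] t, p s = p t + ((t - s : ℝ) : EReal))

theorem isStair_const (c : EReal) : IsStair fun _ => c where
  cont := continuous_const
  anti := antitone_const
  lip _ _ h := le_add_of_nonneg_right (EReal.coe_nonneg.2 (sub_nonneg.2 h))
  right _ := Or.inl (Eventually.of_forall fun _ => rfl)
  left _ := Or.inl (Eventually.of_forall fun _ => rfl)

theorem add_neg_add_sub (a : EReal) (s t : ℝ) :
    a + ((-s : ℝ) : EReal) = a + ((-t : ℝ) : EReal) + ((t - s : ℝ) : EReal) := by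
  rw [add_assoc, ← EReal.coe_add]
  congr 2
  ring

theorem isStair_sub (a : EReal) : IsStair fun t => a + ((-t : ℝ) : EReal) where
  cont := by
    induction a with
    | bot => simpa using continuous_const
    | top => simpa using continuous_const
    | coe a =>
      simp_rw [← EReal.coe_add]
      exact continuous_coe_real_ereal.comp (by fun_prop)
  anti _ _ h := add_le_add le_rfl (EReal.coe_le_coe_iff.2 (neg_le_neg h))
  lip s t h := (add_neg_add_sub a s t).le
  right t := Or.inr (Eventually.of_forall fun s => add_neg_add_sub a s t)
  left t := Or.inr (Eventually.of_forall fun s => add_neg_add_sub a s t)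

/-- Away from a crossing the smaller function decides. At a crossing both branches start at the same
value, and which of the slopes `0` and `-1` is lower depends on the side of `t`; hence the
one-sidedness `hs`. -/
theorem eventually_stair_inf {p q : ℝ → EReal} (hp : Continuous p) (hq : Continuous q) {t : ℝ}
    {l : Filter ℝ} (hl : l ≤ 𝓝 t) (hs : (∀ᶠ s in l, s ≤ t) ∨ (∀ᶠ s in l, t ≤ s))
    (h : (∀ᶠ s in l, p s = p t) ∨ (∀ᶠ s in l, p s = p t + ((t - s : ℝ) : EReal)))
    (h' : (∀ᶠ s in l, q s = q t) ∨ (∀ᶠ s in l, q s = q t + ((t - s : ℝ) : EReal))) :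
    (∀ᶠ s in l, (p ⊓ q) s = (p ⊓ q) t) ∨
      (∀ᶠ s in l, (p ⊓ q) s = (p ⊓ q) t + ((t - s : ℝ) : EReal)) := by
  rcases lt_trichotomy (p t) (q t) with hpq | hpq | hpq
  · have ev : ∀ᶠ s in l, p s < q s :=
      hl (hp.continuousAt.eventually_lt hq.continuousAt hpq)
    refine h.imp (fun h => ?_) (fun h => ?_) <;> filter_upwards [h, ev] with s h1 h2
    · rw [show (p ⊓ q) s = p s from inf_eq_left.2 h2.le,
        show (p ⊓ q) t = p t from inf_eq_left.2 hpq.le, h1]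
    · rw [show (p ⊓ q) s = p s from inf_eq_left.2 h2.le,
        show (p ⊓ q) t = p t from inf_eq_left.2 hpq.le, h1]
  · have neg : ∀ {s : ℝ} (a : EReal), s ≤ t → a ≤ a + ((t - s : ℝ) : EReal) := fun a h =>
      le_add_of_nonneg_right (EReal.coe_nonneg.2 (sub_nonneg.2 h))
    have pos : ∀ {s : ℝ} (a : EReal), t ≤ s → a + ((t - s : ℝ) : EReal) ≤ a := fun a h =>
      add_le_of_nonpos_right (EReal.coe_nonpos.2 (sub_nonpos.2 h))
    simp only [Pi.inf_apply, hpq, inf_idem]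
    rw [hpq] at h
    rcases h with h | h <;> rcases h' with h' | h'
    · left; filter_upwards [h, h'] with s h1 h2; simp [h1, h2]
    · rcases hs with hs | hs
      · left; filter_upwards [h, h', hs] with s h1 h2 h3; simpa [h1, h2] using neg _ h3
      · right; filter_upwards [h, h', hs] with s h1 h2 h3
        rw [h1, h2]; exact inf_eq_right.2 (pos _ h3)
    · rcases hs with hs | hs
      · left; filter_upwards [h, h', hs] with s h1 h2 h3; simpa [h1, h2] using neg _ h3
      · right; filter_upwards [h, h', hs] with s h1 h2 h3
        rw [h1, h2]; exact inf_eq_left.2 (pos _ h3)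
    · right; filter_upwards [h, h'] with s h1 h2; simp [h1, h2]
  · have ev : ∀ᶠ s in l, q s < p s :=
      hl (hq.continuousAt.eventually_lt hp.continuousAt hpq)
    refine h'.imp (fun h => ?_) (fun h => ?_) <;> filter_upwards [h, ev] with s h1 h2
    · rw [show (p ⊓ q) s = q s from inf_eq_right.2 h2.le,
        show (p ⊓ q) t = q t from inf_eq_right.2 hpq.le, h1]
    · rw [show (p ⊓ q) s = q s from inf_eq_right.2 h2.le,
        show (p ⊓ q) t = q t from inf_eq_right.2 hpq.le, h1]

theorem eventually_stair_sup {p q : ℝ → EReal} (hp : Continuous p) (hq : Continuous q) {t : ℝ}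
    {l : Filter ℝ} (hl : l ≤ 𝓝 t) (hs : (∀ᶠ s in l, s ≤ t) ∨ (∀ᶠ s in l, t ≤ s))
    (h : (∀ᶠ s in l, p s = p t) ∨ (∀ᶠ s in l, p s = p t + ((t - s : ℝ) : EReal)))
    (h' : (∀ᶠ s in l, q s = q t) ∨ (∀ᶠ s in l, q s = q t + ((t - s : ℝ) : EReal))) :
    (∀ᶠ s in l, (p ⊔ q) s = (p ⊔ q) t) ∨
      (∀ᶠ s in l, (p ⊔ q) s = (p ⊔ q) t + ((t - s : ℝ) : EReal)) := by
  rcases lt_trichotomy (p t) (q t) with hpq | hpq | hpq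
  · have ev : ∀ᶠ s in l, p s < q s :=
      hl (hp.continuousAt.eventually_lt hq.continuousAt hpq)
    refine h'.imp (fun h => ?_) (fun h => ?_) <;> filter_upwards [h, ev] with s h1 h2
    · rw [show (p ⊔ q) s = q s from sup_eq_right.2 h2.le,
        show (p ⊔ q) t = q t from sup_eq_right.2 hpq.le, h1]
    · rw [show (p ⊔ q) s = q s from sup_eq_right.2 h2.le,
        show (p ⊔ q) t = q t from sup_eq_right.2 hpq.le, h1]
  · have neg : ∀ {s : ℝ} (a : EReal), s ≤ t → a ≤ a + ((t - s : ℝ) : EReal) := fun a h =>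
      le_add_of_nonneg_right (EReal.coe_nonneg.2 (sub_nonneg.2 h))
    have pos : ∀ {s : ℝ} (a : EReal), t ≤ s → a + ((t - s : ℝ) : EReal) ≤ a := fun a h =>
      add_le_of_nonpos_right (EReal.coe_nonpos.2 (sub_nonpos.2 h))
    simp only [Pi.sup_apply, hpq, sup_idem]
    rw [hpq] at h
    rcases h with h | h <;> rcases h' with h' | h'
    · left; filter_upwards [h, h'] with s h1 h2; simp [h1, h2]
    · rcases hs with hs | hs
      · right; filter_upwards [h, h', hs] with s h1 h2 h3
        rw [h1, h2]; exact sup_eq_right.2 (neg _ h3)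
      · left; filter_upwards [h, h', hs] with s h1 h2 h3; simpa [h1, h2] using pos _ h3
    · rcases hs with hs | hs
      · right; filter_upwards [h, h', hs] with s h1 h2 h3
        rw [h1, h2]; exact sup_eq_left.2 (neg _ h3)
      · left; filter_upwards [h, h', hs] with s h1 h2 h3; simpa [h1, h2] using pos _ h3
    · right; filter_upwards [h, h'] with s h1 h2; simp [h1, h2]
  · have ev : ∀ᶠ s in l, q s < p s :=
      hl (hq.continuousAt.eventually_lt hp.continuousAt hpq)
    refine h.imp (fun h => ?_) (fun h => ?_) <;> filter_upwards [h, ev] with s h1 h2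
    · rw [show (p ⊔ q) s = p s from sup_eq_left.2 h2.le,
        show (p ⊔ q) t = p t from sup_eq_left.2 hpq.le, h1]
    · rw [show (p ⊔ q) s = p s from sup_eq_left.2 h2.le,
        show (p ⊔ q) t = p t from sup_eq_left.2 hpq.le, h1]

theorem eventually_le_nhdsLT (t : ℝ) : ∀ᶠ s in 𝓝[<] t, s ≤ t :=
  eventually_nhdsWithin_of_forall fun _ h => le_of_lt h

theorem eventually_ge_nhdsGT (t : ℝ) : ∀ᶠ s in 𝓝[>] t, t ≤ s :=
  eventually_nhdsWithin_of_forall fun _ h => le_of_lt h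

theorem IsStair.inf {p q : ℝ → EReal} (hp : IsStair p) (hq : IsStair q) : IsStair (p ⊓ q) where
  cont := hp.cont.inf hq.cont
  anti := hp.anti.inf hq.anti
  lip s t h := by
    rcases le_total (p t) (q t) with h' | h'
    · simpa [inf_eq_left.2 h'] using Or.inl (hp.lip s t h)
    · simpa [inf_eq_right.2 h'] using Or.inr (hq.lip s t h)
  right t := eventually_stair_inf hp.cont hq.cont nhdsWithin_le_nhds
    (Or.inr (eventually_ge_nhdsGT t)) (hp.right t) (hq.right t)
  left t := eventually_stair_inf hp.cont hq.cont nhdsWithin_le_nhds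
    (Or.inl (eventually_le_nhdsLT t)) (hp.left t) (hq.left t)

theorem IsStair.sup {p q : ℝ → EReal} (hp : IsStair p) (hq : IsStair q) : IsStair (p ⊔ q) where
  cont := hp.cont.sup hq.cont
  anti := hp.anti.sup hq.anti
  lip s t h := sup_le ((hp.lip s t h).trans (add_le_add le_sup_left le_rfl))
    ((hq.lip s t h).trans (add_le_add le_sup_right le_rfl))
  right t := eventually_stair_sup hp.cont hq.cont nhdsWithin_le_nhds
    (Or.inr (eventually_ge_nhdsGT t)) (hp.right t) (hq.right t)
  left t := eventually_stair_sup hp.cont hq.cont nhdsWithin_le_nhds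
    (Or.inl (eventually_le_nhdsLT t)) (hp.left t) (hq.left t)

/-! ### Intervals along diagonals -/

/-- The point of height `σ` on the diagonal `{x | x 0 - x 1 = t}`. -/
def diagPt (t : ℝ) (σ : EReal) : Pt 2 := ![(t : EReal) + σ, σ]

theorem le_pt_iff {x y : Pt 2} : x ≤ y ↔ x 0 ≤ y 0 ∧ x 1 ≤ y 1 := by
  simp [Pi.le_def, Fin.forall_fin_two]

@[simp] theorem diagPt_zero (t : ℝ) (σ : EReal) : diagPt t σ 0 = t + σ := rfl
@[simp] theorem diagPt_one (t : ℝ) (σ : EReal) : diagPt t σ 1 = σ := rfl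

theorem add_neg_le_iff (a σ : EReal) (t : ℝ) : a + ((-t : ℝ) : EReal) ≤ σ ↔ a ≤ t + σ := by
  induction a <;> induction σ <;> simp
  · rw [← EReal.coe_neg, ← EReal.coe_add, ← EReal.coe_add, EReal.coe_le_coe_iff,
      EReal.coe_le_coe_iff]
    constructor <;> intro h <;> linarith
  · exact EReal.coe_ne_top _

theorem le_add_neg_iff (a σ : EReal) (t : ℝ) : σ ≤ a + ((-t : ℝ) : EReal) ↔ t + σ ≤ a := by
  induction a <;> induction σ <;> simp
  · rw [← EReal.coe_neg, ← EReal.coe_add, ← EReal.coe_add, EReal.coe_le_coe_iff,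
      EReal.coe_le_coe_iff]
    constructor <;> intro h <;> linarith
  · exact EReal.coe_ne_top _

/-- The functions `l` and `u` bound the intersections of `I` with the diagonals. -/
structure IsSlab (I : Set (Pt 2)) (l u : ℝ → EReal) : Prop where
  interval : IsInterval I
  stair_lower : IsStair l
  stair_upper : IsStair u
  lower_le : ∀ t σ, l t ≤ σ ↔ ∃ y ∈ I, y ≤ diagPt t σ
  le_upper : ∀ t σ, σ ≤ u t ↔ ∃ y ∈ I, diagPt t σ ≤ y
  lower_ne_top : ∀ t, l t ≠ ⊤
  upper_ne_bot : ∀ t, u t ≠ ⊥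
  closed : IsClosed I
  fat : ∀ x ∈ I, ∃ a b : Pt 2, (∀ i, a i < b i) ∧ a ≤ x ∧ x ≤ b ∧ Set.Icc a b ⊆ I

/-- The lower corner `a` of a rectangle is below the point of height `σ` exactly if `max (a 0 - t)
(a 1) ≤ σ`. The minimum over the rectangles describes the up-closure of `I`, and dually for `u`, so
both functions are defined and continuous also on diagonals that miss `I`, where `u t < l t`. -/
theorem exists_isSlab {I : Set (Pt 2)} (hI : IsInterval I) (R : Finset (Pt 2 × Pt 2))
    (hR : ∀ r ∈ R, ∀ i, r.1 i < r.2 i) (hIR : I = ⋃ r ∈ R, Set.Icc r.1 r.2) :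
    ∃ l u, IsSlab I l u := by
  have ne : R.Nonempty := by
    obtain ⟨x, hx⟩ := hI.nonempty
    rw [hIR] at hx
    simp only [Set.mem_iUnion] at hx
    obtain ⟨r, hr, -⟩ := hx
    exact ⟨r, hr⟩
  have mem : ∀ x, x ∈ I ↔ ∃ r ∈ R, r.1 ≤ x ∧ x ≤ r.2 := fun x => by
    rw [hIR]; simp only [Set.mem_iUnion, Set.mem_Icc, exists_prop]
  have le : ∀ r ∈ R, r.1 ≤ r.2 := fun r hr i => (hR r hr i).le
  refine ⟨R.inf' ne fun r => (fun t => r.1 0 + ((-t : ℝ) : EReal)) ⊔ fun _ => r.1 1,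
    R.sup' ne fun r => (fun t => r.2 0 + ((-t : ℝ) : EReal)) ⊓ fun _ => r.2 1,
    hI, ?_, ?_, ?_, ?_, ?_, ?_, ?_, ?_⟩
  · exact Finset.inf'_induction ne _ (fun _ h _ h' => h.inf h')
      fun r _ => (isStair_sub _).sup (isStair_const _)
  · exact Finset.sup'_induction ne _ (fun _ h _ h' => h.sup h')
      fun r _ => (isStair_sub _).inf (isStair_const _)
  · intro t σ
    rw [Finset.inf'_apply, Finset.inf'_le_iff]
    simp only [Pi.sup_apply, sup_le_iff, add_neg_le_iff]
    constructor
    · rintro ⟨r, hr, h⟩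
      exact ⟨r.1, (mem _).2 ⟨r, hr, le_rfl, le r hr⟩, le_pt_iff.2 h⟩
    · rintro ⟨y, hy, h⟩
      obtain ⟨r, hr, h', -⟩ := (mem y).1 hy
      exact ⟨r, hr, le_pt_iff.1 (h'.trans h)⟩
  · intro t σ
    rw [Finset.sup'_apply, Finset.le_sup'_iff]
    simp only [Pi.inf_apply, le_inf_iff, le_add_neg_iff]
    constructor
    · rintro ⟨r, hr, h⟩
      exact ⟨r.2, (mem _).2 ⟨r, hr, le r hr, le_rfl⟩, le_pt_iff.2 h⟩
    · rintro ⟨y, hy, h⟩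
      obtain ⟨r, hr, -, h'⟩ := (mem y).1 hy
      exact ⟨r, hr, le_pt_iff.1 (h.trans h')⟩
  · intro t
    rw [Finset.inf'_apply, ← lt_top_iff_ne_top, Finset.inf'_lt_iff]
    obtain ⟨r, hr⟩ := ne
    exact ⟨r, hr, sup_lt_iff.2
      ⟨EReal.add_lt_top (lt_top_of_lt (hR r hr 0)).ne (EReal.coe_ne_top _),
        lt_top_of_lt (hR r hr 1)⟩⟩
  · intro t
    rw [Finset.sup'_apply, ← bot_lt_iff_ne_bot, Finset.lt_sup'_iff]
    obtain ⟨r, hr⟩ := ne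
    exact ⟨r, hr, lt_inf_iff.2
      ⟨bot_lt_iff_ne_bot.2 (EReal.add_ne_bot_iff.2
        ⟨(bot_lt_of_lt (hR r hr 0)).ne', EReal.coe_ne_bot _⟩),
        bot_lt_of_lt (hR r hr 1)⟩⟩
  · rw [hIR]
    exact R.finite_toSet.isClosed_biUnion fun r _ => isClosed_Icc
  · intro x hx
    obtain ⟨r, hr, h1, h2⟩ := (mem x).1 hx
    exact ⟨r.1, r.2, hR r hr, h1, h2, fun y hy => (mem y).2 ⟨r, hr, hy.1, hy.2⟩⟩

namespace IsSlab

variable {I : Set (Pt 2)} {l u : ℝ → EReal}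

theorem mem_iff (h : IsSlab I l u) (t : ℝ) (σ : EReal) :
    diagPt t σ ∈ I ↔ l t ≤ σ ∧ σ ≤ u t := by
  rw [h.lower_le, h.le_upper]
  constructor
  · exact fun hx => ⟨⟨_, hx, le_rfl⟩, ⟨_, hx, le_rfl⟩⟩
  · rintro ⟨⟨y, hy, h1⟩, ⟨z, hz, h2⟩⟩
    exact h.interval.convex y hy z hz _ h1 h2

theorem isClosed_le (h : IsSlab I l u) : IsClosed {t | l t ≤ u t} :=
  _root_.isClosed_le h.stair_lower.cont h.stair_upper.cont

theorem mem_of_le (h : IsSlab I l u) {t : ℝ} (ht : l t ≤ u t) : diagPt t (l t) ∈ I :=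
  (h.mem_iff t _).2 ⟨le_rfl, ht⟩

theorem mem_of_le' (h : IsSlab I l u) {t : ℝ} (ht : l t ≤ u t) : diagPt t (u t) ∈ I :=
  (h.mem_iff t _).2 ⟨ht, le_rfl⟩

/-- If the diagonal of `t` misses `I`, a height `c` strictly between `u t` and `l t` gives a point
comparable to no point of `I`. Then `I` lies in the two open quadrants to the upper left and lower
right of that point. No comparability step passes from one to the other, although both are visited.
-/
theorem ordConnected (h : IsSlab I l u) : Set.OrdConnected {t | l t ≤ u t} := by
  refine ⟨fun r hr s hs t ht => ?_⟩
  by_contra hlt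
  obtain ⟨c, hc1, hc2⟩ := EReal.lt_iff_exists_real_btwn.1 (not_le.1 hlt)
  have h1 : ∀ x ∈ I, ¬ x ≤ diagPt t c := fun x hx hle =>
    not_le.2 hc2 ((h.lower_le t c).2 ⟨x, hx, hle⟩)
  have h2 : ∀ x ∈ I, ¬ diagPt t c ≤ x := fun x hx hle =>
    not_le.2 hc1 ((h.le_upper t c).2 ⟨x, hx, hle⟩)
  simp only [le_pt_iff, diagPt_zero, diagPt_one, not_and_or, not_le] at h1 h2
  have step : ∀ x ∈ I, ∀ y ∈ I, x ≤ y ∨ y ≤ x → x 1 > c → y 1 > c := by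
    intro x hx y hy hxy hxc
    rcases h1 y hy with h3 | h3
    · rcases h2 x hx with h4 | h4
      · rcases hxy with hxy | hxy
        · exact hxc.trans_le (hxy 1)
        · exact absurd ((hxy 0).trans_lt h4) h3.not_gt
      · exact absurd h4 hxc.not_gt
    · exact h3
  obtain ⟨m, γ, h0, hm, hmem, hpath⟩ := h.interval.connected _ (h.mem_of_le hr) _ (h.mem_of_le hs)
  have cmp : ∀ k ≤ 2 * m, γ k ≤ γ (k + 1) ∨ γ (k + 1) ≤ γ k := fun k hk =>
    (Nat.even_or_odd k).imp (hpath k hk).1 (hpath k hk).2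
  have start : γ 0 1 > c := by
    rw [h0]
    rcases h1 _ (h.mem_of_le hr) with h3 | h3
    · rcases h2 _ (h.mem_of_le hr) with h4 | h4
      · exact absurd h4 h3.not_gt
      · simp only [diagPt_zero, diagPt_one] at h3 h4
        have := add_le_add (EReal.coe_le_coe_iff.2 ht.1) h4.le
        exact absurd this h3.not_ge
    · exact h3
  have all : ∀ k ≤ 2 * m + 1, γ k 1 > c := by
    intro k
    induction k with
    | zero => exact fun _ => start
    | succ k ih =>
      intro hk
      exact step _ (hmem k (by omega)) _ (hmem _ hk) (cmp k (by omega)) (ih (by omega))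
  have last := all _ le_rfl
  rw [hm] at last
  rcases h2 _ (h.mem_of_le hs) with h4 | h4
  · simp only [diagPt_zero, diagPt_one] at last h4
    have := add_le_add (EReal.coe_le_coe_iff.2 ht.2) (le_of_lt last)
    exact absurd this h4.not_ge
  · exact absurd h4 last.not_gt

end IsSlab

/-! ### Boundary curves -/

/-- The part at real diagonals of a boundary `F` of the interval `I` is the graph of `p` over `T`. -/
structure IsCurve (I F : Set (Pt 2)) (T : Set ℝ) (p : ℝ → EReal) : Prop where
  stair : IsStair p
  side : F = lowerBoundary I ∨ F = upperBoundary I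
  closed : IsClosed F
  diag_mem : ∀ (t σ : ℝ), t ∈ T → p t = σ → diagPt t σ ∈ F
  diag_eq : ∀ (t σ : ℝ), diagPt t σ ∈ F → t ∈ T ∧ p t = σ
  convex : ∀ x ∈ F, ∀ z ∈ F, ∀ y, x ≤ y → y ≤ z → y ∈ F
  left_end : ∀ (t σ σ' : ℝ), diagPt t σ ∈ F → ![⊥, (σ : EReal)] ∈ F → ![⊥, (σ' : EReal)] ∈ F → σ ≤ σ'
  bottom_end : ∀ (t σ a : ℝ), diagPt t σ ∈ F → ![((t + σ : ℝ) : EReal), ⊥] ∈ F →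
    ![(a : EReal), ⊥] ∈ F → t + σ ≤ a
  tip : ∀ (t σ : ℝ), t ∈ T → p t = σ → T ∉ 𝓝 t → diagPt t σ ∈ vertices I

theorem isClosed_lowerBoundary {n : ℕ} (I : Set (Pt n)) : IsClosed (lowerBoundary I) := by
  have : lowerBoundary I = closure I ∩ ⋂ y ∈ I, {x | ∀ i, y i < x i}ᶜ := by
    ext x
    simp only [lowerBoundary, Set.mem_ofPred_eq, Set.mem_inter_iff, Set.mem_iInter,
      Set.mem_compl_iff]
    exact and_congr_right fun _ => ⟨fun h y hy hlt => h y hlt hy, fun h y hlt hy => h y hy hlt⟩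
  rw [this]
  refine isClosed_closure.inter (isClosed_biInter fun y _ => IsOpen.isClosed_compl ?_)
  simp only [Set.ofPred_forall]
  exact isOpen_iInter_of_finite fun i => isOpen_lt continuous_const (continuous_apply i)

theorem isClosed_upperBoundary {n : ℕ} (I : Set (Pt n)) : IsClosed (upperBoundary I) := by
  have : upperBoundary I = closure I ∩ ⋂ y ∈ I, {x | ∀ i, x i < y i}ᶜ := by
    ext x
    simp only [upperBoundary, Set.mem_ofPred_eq, Set.mem_inter_iff, Set.mem_iInter,
      Set.mem_compl_iff]
    exact and_congr_right fun _ => ⟨fun h y hy hlt => h y hlt hy, fun h y hlt hy => h y hy hlt⟩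
  rw [this]
  refine isClosed_closure.inter (isClosed_biInter fun y _ => IsOpen.isClosed_compl ?_)
  simp only [Set.ofPred_forall]
  exact isOpen_iInter_of_finite fun i => isOpen_lt (continuous_apply i) continuous_const

theorem pt_eq_diagPt (a b : ℝ) : (![(a : EReal), (b : EReal)] : Pt 2) = diagPt (a - b) b := by
  ext i
  fin_cases i
  · change (a : EReal) = ((a - b : ℝ) : EReal) + (b : EReal)
    rw [← EReal.coe_add, sub_add_cancel]
  · rfl

theorem coe_diagPt_zero (t σ : ℝ) : diagPt t σ 0 = ((t + σ : ℝ) : EReal) := by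
  simp

namespace IsSlab

variable {I : Set (Pt 2)} {l u : ℝ → EReal}

theorem dom_of_mem (h : IsSlab I l u) {a b : ℝ} (hx : ![(a : EReal), (b : EReal)] ∈ I) :
    a - b ∈ {t | l t ≤ u t} := by
  rw [pt_eq_diagPt, h.mem_iff] at hx
  exact hx.1.trans hx.2

/-- On the last diagonal nothing of `I` lies to the right of the point at its height, or below it.
So the point is the lower right corner of any rectangle of `I` through it, and the right end of a
horizontal edge of the lower boundary. -/
theorem tip_right (h : IsSlab I l u) {t σ : ℝ} (ht : diagPt t σ ∈ I)
    (hmax : ∀ s, l s ≤ u s → s ≤ t) : diagPt t σ ∈ vertices I := by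
  have right : ∀ c : ℝ, t + σ < c → ![(c : EReal), (σ : EReal)] ∉ I := fun c hc hx => by
    have := hmax _ (h.dom_of_mem hx)
    linarith
  have below : ∀ y ∈ I, y 0 ≤ diagPt t σ 0 → y 1 < σ → False := by
    intro y hy h0 h1
    obtain ⟨c, hc1, hc2⟩ := EReal.lt_iff_exists_real_btwn.1 h1
    have hx : ![((t + σ : ℝ) : EReal), (c : EReal)] ∈ I := by
      refine h.interval.convex y hy _ ht _ (le_pt_iff.2 ⟨?_, hc1.le⟩) (le_pt_iff.2 ⟨?_, hc2.le⟩)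
      · simpa using h0
      · simp
    have := hmax _ (h.dom_of_mem hx)
    have := EReal.coe_lt_coe_iff.1 hc2
    linarith
  obtain ⟨a, b, hab, haz, hzb, hsub⟩ := h.fat _ ht
  have ha1 : a 1 = σ := by
    refine le_antisymm (haz 1) (not_lt.1 fun hlt => ?_)
    refine below ![diagPt t σ 0, a 1] (hsub ⟨le_pt_iff.2 ⟨haz 0, le_rfl⟩,
      le_pt_iff.2 ⟨hzb 0, (haz 1).trans (hzb 1)⟩⟩) le_rfl hlt
  have hb0 : b 0 = ((t + σ : ℝ) : EReal) := by
    refine le_antisymm (not_lt.1 fun hlt => ?_) (by simpa using hzb 0)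
    obtain ⟨c, hc1, hc2⟩ := EReal.lt_iff_exists_real_btwn.1 hlt
    refine right c (EReal.coe_lt_coe_iff.1 hc1) (hsub ⟨le_pt_iff.2 ⟨?_, haz 1⟩,
      le_pt_iff.2 ⟨hc2.le, hzb 1⟩⟩)
    exact (haz 0).trans (by simpa using hc1.le)
  have hz : diagPt t σ ∈ lowerBoundary I :=
    ⟨subset_closure ht, fun y hy hyI => below y hyI (hy 0).le (hy 1)⟩
  refine ⟨{x | x ∈ lowerBoundary I ∧ x 1 = σ}, ⟨?_, _, Or.inl rfl, 1, σ, rfl⟩, Or.inr ⟨⟨hz, rfl⟩, ?_⟩⟩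
  · refine ⟨_, ⟨hz, rfl⟩, ![a 0, σ], ⟨⟨subset_closure (hsub ⟨?_, ?_⟩), ?_⟩, rfl⟩, ?_⟩
    · exact le_pt_iff.2 ⟨le_rfl, haz 1⟩
    · exact le_pt_iff.2 ⟨(hab 0).le, hzb 1⟩
    · exact fun y hy hyI => below y hyI ((hy 0).le.trans (haz 0)) (hy 1)
    · intro e
      have := congrFun e 0
      have h0 := hab 0
      rw [hb0] at h0
      simp only [coe_diagPt_zero] at this
      exact h0.ne this.symm
  · rintro x ⟨hx, hx1⟩
    have hxI := h.closed.closure_eq ▸ hx.1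
    refine le_pt_iff.2 ⟨not_lt.1 fun hlt => ?_, hx1.le⟩
    rw [coe_diagPt_zero] at hlt
    obtain ⟨c, hc1, hc2⟩ := EReal.lt_iff_exists_real_btwn.1 hlt
    refine right c (EReal.coe_lt_coe_iff.1 hc1) (h.interval.convex _ ht x hxI _
      (le_pt_iff.2 ⟨?_, le_rfl⟩) (le_pt_iff.2 ⟨hc2.le, hx1.ge⟩))
    rw [coe_diagPt_zero]
    exact hc1.le

/-- Mirror image of `tip_right`: the point is an upper left corner and the left end of a horizontal
edge of the upper boundary. -/
theorem tip_left (h : IsSlab I l u) {t σ : ℝ} (ht : diagPt t σ ∈ I)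
    (hmin : ∀ s, l s ≤ u s → t ≤ s) : diagPt t σ ∈ vertices I := by
  have left : ∀ c : ℝ, c < t + σ → ![(c : EReal), (σ : EReal)] ∉ I := fun c hc hx => by
    have := hmin _ (h.dom_of_mem hx)
    linarith
  have above : ∀ y ∈ I, diagPt t σ 0 ≤ y 0 → σ < y 1 → False := by
    intro y hy h0 h1
    obtain ⟨c, hc1, hc2⟩ := EReal.lt_iff_exists_real_btwn.1 h1
    have hx : ![((t + σ : ℝ) : EReal), (c : EReal)] ∈ I := by
      refine h.interval.convex _ ht y hy _ (le_pt_iff.2 ⟨?_, hc1.le⟩) (le_pt_iff.2 ⟨?_, hc2.le⟩)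
      · simp
      · simpa using h0
    have := hmin _ (h.dom_of_mem hx)
    have := EReal.coe_lt_coe_iff.1 hc1
    linarith
  obtain ⟨a, b, hab, haz, hzb, hsub⟩ := h.fat _ ht
  have hb1 : b 1 = σ := by
    refine le_antisymm (not_lt.1 fun hlt => ?_) (hzb 1)
    refine above ![diagPt t σ 0, b 1] (hsub ⟨le_pt_iff.2 ⟨haz 0, (haz 1).trans (hzb 1)⟩,
      le_pt_iff.2 ⟨hzb 0, le_rfl⟩⟩) le_rfl hlt
  have ha0 : a 0 = ((t + σ : ℝ) : EReal) := by
    refine le_antisymm (by simpa using haz 0) (not_lt.1 fun hlt => ?_)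
    obtain ⟨c, hc1, hc2⟩ := EReal.lt_iff_exists_real_btwn.1 hlt
    refine left c (EReal.coe_lt_coe_iff.1 hc2) (hsub ⟨le_pt_iff.2 ⟨hc1.le, haz 1⟩,
      le_pt_iff.2 ⟨?_, hzb 1⟩⟩)
    exact le_trans (by simpa using hc2.le) (hzb 0)
  have hz : diagPt t σ ∈ upperBoundary I :=
    ⟨subset_closure ht, fun y hy hyI => above y hyI (hy 0).le (hy 1)⟩
  refine ⟨{x | x ∈ upperBoundary I ∧ x 1 = σ}, ⟨?_, _, Or.inr rfl, 1, σ, rfl⟩, Or.inl ⟨⟨hz, rfl⟩, ?_⟩⟩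
  · refine ⟨_, ⟨hz, rfl⟩, ![b 0, σ], ⟨⟨subset_closure (hsub ⟨?_, ?_⟩), ?_⟩, rfl⟩, ?_⟩
    · exact le_pt_iff.2 ⟨(hab 0).le, haz 1⟩
    · exact le_pt_iff.2 ⟨le_rfl, hzb 1⟩
    · exact fun y hy hyI => above y hyI ((hzb 0).trans (hy 0).le) (hy 1)
    · intro e
      have := congrFun e 0
      have h0 := hab 0
      rw [ha0] at h0
      simp only [coe_diagPt_zero] at this
      exact h0.ne this
  · rintro x ⟨hx, hx1⟩
    have hxI := h.closed.closure_eq ▸ hx.1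
    refine le_pt_iff.2 ⟨not_lt.1 fun hlt => ?_, hx1.ge⟩
    rw [coe_diagPt_zero] at hlt
    obtain ⟨c, hc1, hc2⟩ := EReal.lt_iff_exists_real_btwn.1 hlt
    refine left c (EReal.coe_lt_coe_iff.1 hc2) (h.interval.convex x hxI _ ht _
      (le_pt_iff.2 ⟨hc1.le, hx1.le⟩) (le_pt_iff.2 ⟨?_, le_rfl⟩))
    rw [coe_diagPt_zero]
    exact hc2.le

theorem tip (h : IsSlab I l u) {t σ : ℝ} (ht : diagPt t σ ∈ I)
    (hn : {t | l t ≤ u t} ∉ 𝓝 t) : diagPt t σ ∈ vertices I := by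
  by_cases hmax : ∀ s, l s ≤ u s → s ≤ t
  · exact h.tip_right ht hmax
  · by_cases hmin : ∀ s, l s ≤ u s → t ≤ s
    · exact h.tip_left ht hmin
    · push Not at hmax hmin
      obtain ⟨s, hs, hts⟩ := hmax
      obtain ⟨r, hr, hrt⟩ := hmin
      exact absurd (mem_of_superset (Icc_mem_nhds hrt hts) (h.ordConnected.out hr hs)) hn

theorem not_mem_of_lt_lower (h : IsSlab I l u) {t σ : ℝ} (hσ : l t = σ) {y : Pt 2}
    (h0 : y 0 < diagPt t σ 0) (h1 : y 1 < σ) : y ∉ I := by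
  intro hy
  have : y 0 + ((-t : ℝ) : EReal) < σ := not_le.1 fun hle =>
    absurd ((le_add_neg_iff _ _ _).1 hle) h0.not_ge
  -- The maximum is the height of the lowest point of this diagonal above `y`.
  have hle := (h.lower_le t (max (y 0 + ((-t : ℝ) : EReal)) (y 1))).2 ⟨y, hy, le_pt_iff.2
    ⟨(add_neg_le_iff _ _ _).1 (le_max_left _ _), le_max_right _ _⟩⟩
  rw [hσ] at hle
  exact hle.not_gt (max_lt this h1)

theorem not_mem_of_upper_lt (h : IsSlab I l u) {t σ : ℝ} (hσ : u t = σ) {y : Pt 2}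
    (h0 : diagPt t σ 0 < y 0) (h1 : σ < y 1) : y ∉ I := by
  intro hy
  have : σ < y 0 + ((-t : ℝ) : EReal) := not_le.1 fun hle =>
    absurd ((add_neg_le_iff _ _ _).1 hle) h0.not_ge
  have hle := (h.le_upper t (min (y 0 + ((-t : ℝ) : EReal)) (y 1))).2 ⟨y, hy, le_pt_iff.2
    ⟨(le_add_neg_iff _ _ _).1 (min_le_left _ _), min_le_right _ _⟩⟩
  rw [hσ] at hle
  exact hle.not_gt (lt_min this h1)

theorem coe_add_lt_coe_add {a b : EReal} (t : ℝ) (h : a < b) : (t : EReal) + a < t + b :=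
  EReal.add_lt_add_left_coe h t

theorem isCurve_lower (h : IsSlab I l u) : IsCurve I (lowerBoundary I) {t | l t ≤ u t} l where
  stair := h.stair_lower
  side := Or.inl rfl
  closed := isClosed_lowerBoundary I
  diag_mem t σ ht hσ := ⟨subset_closure (hσ ▸ h.mem_of_le ht),
    fun y hy => h.not_mem_of_lt_lower hσ (hy 0) (hy 1)⟩
  diag_eq t σ hx := by
    have hxI := (h.mem_iff t σ).1 (h.closed.closure_eq ▸ hx.1)
    refine ⟨hxI.1.trans hxI.2, le_antisymm hxI.1 (not_lt.1 fun hlt => ?_)⟩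
    refine hx.2 (diagPt t (l t)) ?_ (h.mem_of_le (hxI.1.trans hxI.2))
    rw [Fin.forall_fin_two]
    exact ⟨coe_add_lt_coe_add t hlt, hlt⟩
  convex x hx z hz y hxy hyz := by
    have hxI := h.closed.closure_eq ▸ hx.1
    have hzI := h.closed.closure_eq ▸ hz.1
    exact ⟨subset_closure (h.interval.convex x hxI z hzI y hxy hyz),
      fun w hw => hz.2 w fun i => (hw i).trans_le (hyz i)⟩
  left_end t σ σ' hx _ hx' := by
    by_contra hlt
    refine hx.2 _ ?_ (h.closed.closure_eq ▸ hx'.1)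
    rw [Fin.forall_fin_two, coe_diagPt_zero]
    exact ⟨EReal.bot_lt_coe _, EReal.coe_lt_coe_iff.2 (not_le.1 hlt)⟩
  bottom_end t σ a hx _ hx' := by
    by_contra hlt
    refine hx.2 _ ?_ (h.closed.closure_eq ▸ hx'.1)
    rw [Fin.forall_fin_two, coe_diagPt_zero]
    exact ⟨EReal.coe_lt_coe_iff.2 (not_le.1 hlt), EReal.bot_lt_coe _⟩
  tip t σ ht hσ hn := h.tip (hσ ▸ h.mem_of_le ht) hn

theorem isCurve_upper (h : IsSlab I l u) : IsCurve I (upperBoundary I) {t | l t ≤ u t} u where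
  stair := h.stair_upper
  side := Or.inr rfl
  closed := isClosed_upperBoundary I
  diag_mem t σ ht hσ := ⟨subset_closure (hσ ▸ h.mem_of_le' ht),
    fun y hy => h.not_mem_of_upper_lt hσ (hy 0) (hy 1)⟩
  diag_eq t σ hx := by
    have hxI := (h.mem_iff t σ).1 (h.closed.closure_eq ▸ hx.1)
    refine ⟨hxI.1.trans hxI.2, le_antisymm (not_lt.1 fun hlt => ?_) hxI.2⟩
    refine hx.2 (diagPt t (u t)) ?_ (h.mem_of_le' (hxI.1.trans hxI.2))
    rw [Fin.forall_fin_two]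
    exact ⟨coe_add_lt_coe_add t hlt, hlt⟩
  convex x hx z hz y hxy hyz := by
    have hxI := h.closed.closure_eq ▸ hx.1
    have hzI := h.closed.closure_eq ▸ hz.1
    exact ⟨subset_closure (h.interval.convex x hxI z hzI y hxy hyz),
      fun w hw => hx.2 w fun i => (hxy i).trans_lt (hw i)⟩
  left_end t σ σ' _ hx hx' := by
    by_contra hlt
    -- A rectangle through the point at infinity reaches real abscissas, and its points at height
    -- `σ` are strictly above the lower point.
    obtain ⟨a, b, hab, haz, hzb, hsub⟩ := h.fat _ (h.closed.closure_eq ▸ hx.1)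
    refine hx'.2 ![b 0, σ] ?_ (hsub ⟨le_pt_iff.2 ⟨(hab 0).le, haz 1⟩, le_pt_iff.2 ⟨le_rfl, hzb 1⟩⟩)
    rw [Fin.forall_fin_two]
    exact ⟨bot_lt_of_lt (hab 0), EReal.coe_lt_coe_iff.2 (not_le.1 hlt)⟩
  bottom_end t σ a' _ hx hx' := by
    by_contra hlt
    obtain ⟨a, b, hab, haz, hzb, hsub⟩ := h.fat _ (h.closed.closure_eq ▸ hx.1)
    refine hx'.2 ![((t + σ : ℝ) : EReal), b 1] ?_
      (hsub ⟨le_pt_iff.2 ⟨haz 0, (hab 1).le⟩, le_pt_iff.2 ⟨hzb 0, le_rfl⟩⟩)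
    rw [Fin.forall_fin_two]
    exact ⟨EReal.coe_lt_coe_iff.2 (not_le.1 hlt), bot_lt_of_lt (hab 1)⟩
  tip t σ ht hσ hn := h.tip (hσ ▸ h.mem_of_le' ht) hn

end IsSlab

/-! ### Corners and ends of edges on a boundary curve -/

theorem eventually_nhds_of_sides {t : ℝ} {P : ℝ → Prop} (h₁ : ∀ᶠ s in 𝓝[<] t, P s)
    (h₂ : ∀ᶠ s in 𝓝[>] t, P s) (h : P t) : ∀ᶠ s in 𝓝 t, P s := by
  rw [← pure_sup_nhdsNE, ← nhdsLT_sup_nhdsGT, eventually_sup, eventually_sup]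
  exact ⟨h, h₁, h₂⟩

namespace IsCurve

variable {I F : Set (Pt 2)} {T : Set ℝ} {p : ℝ → EReal}

theorem vertex_of_isLeast (h : IsCurve I F T p) {i : Fin 2} {c : EReal} {v w : Pt 2}
    (hv : IsLeast {x | x ∈ F ∧ x i = c} v) (hw : w ∈ F ∧ w i = c) (hne : w ≠ v) :
    v ∈ vertices I :=
  ⟨_, ⟨⟨w, hw, v, hv.1, hne⟩, F, h.side, i, c, rfl⟩, Or.inl hv⟩

theorem vertex_of_isGreatest (h : IsCurve I F T p) {i : Fin 2} {c : EReal} {v w : Pt 2}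
    (hv : IsGreatest {x | x ∈ F ∧ x i = c} v) (hw : w ∈ F ∧ w i = c) (hne : w ≠ v) :
    v ∈ vertices I :=
  ⟨_, ⟨⟨w, hw, v, hv.1, hne⟩, F, h.side, i, c, rfl⟩, Or.inr hv⟩

theorem diagPt_ne {s t : ℝ} {σ τ : ℝ} (h : s ≠ t) : diagPt s σ ≠ diagPt t τ := by
  intro e
  have h0 := congrFun e 0
  have h1 := congrFun e 1
  simp only [coe_diagPt_zero, diagPt_one, EReal.coe_eq_coe_iff] at h0 h1
  apply h
  linarith

/-- Points between two points of a boundary curve at the same height. -/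
theorem eq_on_horizontal (h : IsCurve I F T p) {σ t : ℝ} {x z : Pt 2} (hx : x ∈ F) (hz : z ∈ F)
    (hx1 : x 1 = σ) (hz1 : z 1 = σ) (hxt : x 0 ≤ ((t + σ : ℝ) : EReal))
    (hzt : ((t + σ : ℝ) : EReal) ≤ z 0) : t ∈ T ∧ p t = σ := by
  refine h.diag_eq t σ (h.convex x hx z hz _ (le_pt_iff.2 ⟨?_, hx1.le⟩)
    (le_pt_iff.2 ⟨?_, hz1.ge⟩))
  · rwa [coe_diagPt_zero]
  · rwa [coe_diagPt_zero]

theorem eq_on_vertical (h : IsCurve I F T p) {c t : ℝ} {x z : Pt 2} (hx : x ∈ F) (hz : z ∈ F)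
    (hx0 : x 0 = c) (hz0 : z 0 = c) (hxt : x 1 ≤ ((c - t : ℝ) : EReal))
    (hzt : ((c - t : ℝ) : EReal) ≤ z 1) : t ∈ T ∧ p t = ((c - t : ℝ) : EReal) := by
  have e : diagPt t ((c - t : ℝ) : EReal) 0 = c := by
    rw [coe_diagPt_zero]
    congr 1
    ring
  exact h.diag_eq t (c - t) (h.convex x hx z hz _ (le_pt_iff.2 ⟨(hx0.trans e.symm).le, hxt⟩)
    (le_pt_iff.2 ⟨(e.trans hz0.symm).le, hzt⟩))

/-- A change of slope is a corner. With slopes `0` and then `-1` the point is the right end of a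
horizontal edge, in the opposite order the left end: by convexity, a further boundary point at the
same height would make the curve constant on the other side as well. -/
theorem vertex_or_affine (h : IsCurve I F T p) {t σ : ℝ} (ht : t ∈ T) (hσ : p t = σ) :
    diagPt t σ ∈ vertices I ∨ (T ∈ 𝓝 t ∧
      ((∀ᶠ s in 𝓝 t, p s = σ) ∨ (∀ᶠ s in 𝓝 t, p s = ((t + σ - s : ℝ) : EReal)))) := by
  by_cases hT : T ∈ 𝓝 t
  swap
  · exact Or.inl (h.tip t σ ht hσ hT)
  have e : ∀ s : ℝ, p t + ((t - s : ℝ) : EReal) = ((t + σ - s : ℝ) : EReal) := fun s => by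
    rw [hσ, ← EReal.coe_add]
    congr 1
    ring
  have hr := h.stair.right t
  have hl := h.stair.left t
  simp only [e] at hr hl
  rw [hσ] at hr hl
  have hz := h.diag_mem t σ ht hσ
  rcases hl with hl | hl <;> rcases hr with hr | hr
  · exact Or.inr ⟨hT, Or.inl (eventually_nhds_of_sides hl hr hσ)⟩
  · left
    obtain ⟨s, ⟨hs1, hs2⟩, hs3⟩ := ((hl.and (nhdsWithin_le_nhds hT)).and
      (eventually_mem_nhdsWithin (a := t) (s := Set.Iio t))).exists
    refine h.vertex_of_isGreatest (i := 1) (c := σ) ⟨⟨hz, rfl⟩, ?_⟩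
      ⟨h.diag_mem s σ hs2 hs1, rfl⟩ (diagPt_ne (ne_of_lt hs3))
    rintro x ⟨hx, hx1⟩
    refine le_pt_iff.2 ⟨not_lt.1 fun hlt => ?_, hx1.le⟩
    rw [coe_diagPt_zero] at hlt
    obtain ⟨c, hc1, hc2⟩ := EReal.lt_iff_exists_real_btwn.1 hlt
    have hc1' := EReal.coe_lt_coe_iff.1 hc1
    obtain ⟨r, hr1, hr2⟩ := (hr.and (Ioo_mem_nhdsGT (show t < c - σ by linarith))).exists
    have := (h.eq_on_horizontal (t := r) hz hx rfl hx1
      (by rw [coe_diagPt_zero]; exact EReal.coe_le_coe_iff.2 (by linarith [hr2.1]))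
      (le_trans (EReal.coe_le_coe_iff.2 (by linarith [hr2.2])) hc2.le)).2
    rw [hr1, EReal.coe_eq_coe_iff] at this
    linarith [hr2.1]
  · left
    obtain ⟨s, ⟨hs1, hs2⟩, hs3⟩ := ((hr.and (nhdsWithin_le_nhds hT)).and
      (eventually_mem_nhdsWithin (a := t) (s := Set.Ioi t))).exists
    refine h.vertex_of_isLeast (i := 1) (c := σ) ⟨⟨hz, rfl⟩, ?_⟩
      ⟨h.diag_mem s σ hs2 hs1, rfl⟩ (diagPt_ne (ne_of_gt hs3))
    rintro x ⟨hx, hx1⟩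
    refine le_pt_iff.2 ⟨not_lt.1 fun hlt => ?_, hx1.ge⟩
    rw [coe_diagPt_zero] at hlt
    obtain ⟨c, hc1, hc2⟩ := EReal.lt_iff_exists_real_btwn.1 hlt
    have hc2' := EReal.coe_lt_coe_iff.1 hc2
    obtain ⟨r, hr1, hr2⟩ := (hl.and (Ioo_mem_nhdsLT (show c - σ < t by linarith))).exists
    have := (h.eq_on_horizontal (t := r) hx hz hx1 rfl
      (le_trans hc1.le (EReal.coe_le_coe_iff.2 (by linarith [hr2.1])))
      (by rw [coe_diagPt_zero]; exact EReal.coe_le_coe_iff.2 (by linarith [hr2.2]))).2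
    rw [hr1, EReal.coe_eq_coe_iff] at this
    linarith [hr2.2]
  · exact Or.inr ⟨hT, Or.inr (eventually_nhds_of_sides hl hr (by rw [hσ]; congr 1; ring))⟩

theorem exists_isLeast (h : IsCurve I F T p) {i j : Fin 2} (hij : ∀ k, k = i ∨ k = j) {c : EReal}
    {z : Pt 2} (hz : z ∈ F ∧ z i = c) : ∃ v, IsLeast {x | x ∈ F ∧ x i = c} v := by
  have hc : IsCompact {x : Pt 2 | x ∈ F ∧ x i = c} :=
    (h.closed.inter (isClosed_eq (continuous_apply i) continuous_const)).isCompact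
  obtain ⟨v, hv, hmin⟩ := hc.exists_isMinOn ⟨z, hz⟩ (continuous_apply j).continuousOn
  refine ⟨v, hv, fun x hx k => ?_⟩
  rcases hij k with rfl | rfl
  · exact (hv.2.trans hx.2.symm).le
  · exact hmin hx

/-- The edge through the point is compact, since `EReal` is, so it has a left end. This is a vertex,
either at a real diagonal or with abscissa `⊥`, and by convexity the curve is constant up to it. -/
theorem horizontal_end (h : IsCurve I F T p) {t σ : ℝ} (hT : T ∈ 𝓝 t)
    (hp : ∀ᶠ s in 𝓝 t, p s = σ) :
    (∃ t' ≤ t, diagPt t' σ ∈ vertices I ∧ ∀ s, t' ≤ s → s ≤ t → s ∈ T ∧ p s = σ) ∨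
    (![⊥, (σ : EReal)] ∈ vertices I ∧ ![⊥, (σ : EReal)] ∈ F ∧ diagPt t σ ∈ F ∧
      ∀ s ≤ t, s ∈ T ∧ p s = σ) := by
  have hz : diagPt t σ ∈ F := h.diag_mem t σ (mem_of_mem_nhds hT) hp.self_of_nhds
  obtain ⟨v, hv⟩ := h.exists_isLeast (i := 1) (j := 0) (c := σ) (by decide) ⟨hz, rfl⟩
  obtain ⟨s, ⟨hs1, hs2⟩, hs3⟩ := (((hp.and (show ∀ᶠ s in 𝓝 t, s ∈ T from hT)).filter_mono
      (nhdsWithin_le_nhds (s := Set.Ioi t))).and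
      (eventually_mem_nhdsWithin (a := t) (s := Set.Ioi t))).exists
  have hvz : v 0 ≤ ((t + σ : ℝ) : EReal) := by
    rw [← coe_diagPt_zero]; exact hv.2 ⟨hz, rfl⟩ 0
  have hvV : v ∈ vertices I := by
    refine h.vertex_of_isLeast hv (w := diagPt s σ) ⟨h.diag_mem s σ hs2 hs1, rfl⟩ fun e => ?_
    rw [← e, coe_diagPt_zero, EReal.coe_le_coe_iff] at hvz
    linarith [show t < s from hs3]
  have between : ∀ r : ℝ, v 0 ≤ ((r + σ : ℝ) : EReal) → r ≤ t → r ∈ T ∧ p r = σ := fun r h1 h2 =>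
    h.eq_on_horizontal hv.1.1 hz hv.1.2 rfl h1
      (by rw [coe_diagPt_zero]; exact EReal.coe_le_coe_iff.2 (by linarith))
  rcases eq_or_ne (v 0) ⊥ with hb | hb
  · right
    have e : v = ![⊥, (σ : EReal)] := by
      ext i; fin_cases i
      · exact hb
      · exact hv.1.2
    exact ⟨e ▸ hvV, e ▸ hv.1.1, hz, fun s hs => between s (by simp [hb]) hs⟩
  · left
    have hr : v 0 = (((v 0).toReal : ℝ) : EReal) :=
      (EReal.coe_toReal (hvz.trans_lt (EReal.coe_lt_top _)).ne hb).symm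
    set c := (v 0).toReal
    have e : v = diagPt (c - σ) σ := by
      rw [← pt_eq_diagPt]
      ext i; fin_cases i
      · exact hr
      · exact hv.1.2
    rw [hr, EReal.coe_le_coe_iff] at hvz
    refine ⟨c - σ, by linarith, e ▸ hvV, fun s h1 h2 => between s ?_ h2⟩
    rw [hr, EReal.coe_le_coe_iff]
    linarith

/-- Going down a vertical edge increases `t`; the lower end is a vertex, possibly with ordinate `⊥`.
-/
theorem vertical_end (h : IsCurve I F T p) {t σ : ℝ} (hT : T ∈ 𝓝 t)
    (hp : ∀ᶠ s in 𝓝 t, p s = ((t + σ - s : ℝ) : EReal)) :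
    (∃ t' ≥ t, diagPt t' ((t + σ - t' : ℝ) : EReal) ∈ vertices I ∧
      ∀ s, t ≤ s → s ≤ t' → s ∈ T ∧ p s = ((t + σ - s : ℝ) : EReal)) ∨
    (![((t + σ : ℝ) : EReal), ⊥] ∈ vertices I ∧ ![((t + σ : ℝ) : EReal), ⊥] ∈ F ∧ diagPt t σ ∈ F ∧
      ∀ s, t ≤ s → s ∈ T ∧ p s = ((t + σ - s : ℝ) : EReal)) := by
  have hz : diagPt t σ ∈ F := h.diag_mem t σ (mem_of_mem_nhds hT)
    (by rw [hp.self_of_nhds]; congr 1; ring)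
  have hz0 := coe_diagPt_zero t σ
  obtain ⟨v, hv⟩ := h.exists_isLeast (i := 0) (j := 1) (c := ((t + σ : ℝ) : EReal)) (by decide)
    ⟨hz, hz0⟩
  obtain ⟨s, ⟨hs1, hs2⟩, hs3⟩ := (((hp.and (show ∀ᶠ s in 𝓝 t, s ∈ T from hT)).filter_mono
      (nhdsWithin_le_nhds (s := Set.Iio t))).and
      (eventually_mem_nhdsWithin (a := t) (s := Set.Iio t))).exists
  have hvz : v 1 ≤ (σ : EReal) := hv.2 ⟨hz, hz0⟩ 1
  have hvV : v ∈ vertices I := by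
    refine h.vertex_of_isLeast hv (w := diagPt s ((t + σ - s : ℝ) : EReal))
      ⟨h.diag_mem s _ hs2 hs1, by rw [coe_diagPt_zero]; congr 1; ring⟩ fun e => ?_
    rw [← e, diagPt_one, EReal.coe_le_coe_iff] at hvz
    linarith [show s < t from hs3]
  have between : ∀ r : ℝ, v 1 ≤ ((t + σ - r : ℝ) : EReal) → t ≤ r →
      r ∈ T ∧ p r = ((t + σ - r : ℝ) : EReal) := fun r h1 h2 =>
    h.eq_on_vertical hv.1.1 hz hv.1.2 hz0 h1 (EReal.coe_le_coe_iff.2 (by linarith))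
  rcases eq_or_ne (v 1) ⊥ with hb | hb
  · right
    have e : v = ![((t + σ : ℝ) : EReal), ⊥] := by
      ext i; fin_cases i
      · exact hv.1.2
      · exact hb
    exact ⟨e ▸ hvV, e ▸ hv.1.1, hz, fun s hs => between s (by simp [hb]) hs⟩
  · left
    have hr : v 1 = (((v 1).toReal : ℝ) : EReal) :=
      (EReal.coe_toReal (hvz.trans_lt (EReal.coe_lt_top _)).ne hb).symm
    set c := (v 1).toReal
    have e : v = diagPt (t + σ - c) ((t + σ - (t + σ - c) : ℝ) : EReal) := by
      rw [show t + σ - (t + σ - c) = c by ring, ← pt_eq_diagPt]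
      ext i; fin_cases i
      · exact hv.1.2
      · exact hr
    rw [hr, EReal.coe_le_coe_iff] at hvz
    refine ⟨t + σ - c, by linarith, e ▸ hvV, fun s h1 h2 => between s ?_ h1⟩
    rw [hr, EReal.coe_le_coe_iff]
    linarith

end IsCurve

/-! ### Diagonal distances between boundary curves -/

theorem translate_diagPt (a t σ : ℝ) : translate a (diagPt t σ) = diagPt t ((σ + a : ℝ) : EReal) := by
  ext i
  fin_cases i
  · change diagPt t σ 0 + (a : EReal) = diagPt t _ 0
    rw [coe_diagPt_zero, coe_diagPt_zero, ← EReal.coe_add]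
    congr 1
    ring
  · exact (EReal.coe_add _ _).symm

theorem translate_left (a σ : ℝ) :
    translate a ![⊥, (σ : EReal)] = ![⊥, ((σ + a : ℝ) : EReal)] := by
  ext i
  fin_cases i
  · exact EReal.bot_add _
  · exact (EReal.coe_add _ _).symm

theorem translate_bottom (a c : ℝ) :
    translate a ![(c : EReal), ⊥] = ![((c + a : ℝ) : EReal), ⊥] := by
  ext i
  fin_cases i
  · exact (EReal.coe_add _ _).symm
  · exact EReal.bot_add _

open Classical in
theorem ite_abs_coe_sub (a b : ℝ) :
    (if (a : EReal) = b then 0 else ((a : EReal) - b).abs) = ENNReal.ofReal |a - b| := by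
  rw [← EReal.coe_sub, EReal.abs_def]
  split_ifs with h
  · rw [EReal.coe_eq_coe_iff.1 h]; simp
  · rfl

open Classical in
theorem distInf_two (x y : Pt 2) : distInf x y =
    max (if x 0 = y 0 then 0 else (x 0 - y 0).abs) (if x 1 = y 1 then 0 else (x 1 - y 1).abs) := by
  unfold distInf
  refine le_antisymm (iSup_le fun i => ?_) (max_le ?_ ?_)
  · fin_cases i
    · exact le_max_left _ _
    · exact le_max_right _ _
  · exact le_iSup (fun i => if x i = y i then 0 else (x i - y i).abs) 0
  · exact le_iSup (fun i => if x i = y i then 0 else (x i - y i).abs) 1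

theorem distInf_diagPt (t σ τ : ℝ) :
    distInf (diagPt t σ) (diagPt t τ) = ENNReal.ofReal |σ - τ| := by
  rw [distInf_two, coe_diagPt_zero, coe_diagPt_zero, diagPt_one, diagPt_one, ite_abs_coe_sub,
    ite_abs_coe_sub, add_sub_add_left_eq_sub, max_self]

theorem distInf_left (σ τ : ℝ) :
    distInf ![⊥, (σ : EReal)] ![⊥, (τ : EReal)] = ENNReal.ofReal |σ - τ| := by
  rw [distInf_two]
  simp [-EReal.coe_eq_coe_iff]
  exact ite_abs_coe_sub σ τ

theorem distInf_bottom (σ τ : ℝ) :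
    distInf ![(σ : EReal), ⊥] ![(τ : EReal), ⊥] = ENNReal.ofReal |σ - τ| := by
  rw [distInf_two]
  simp [-EReal.coe_eq_coe_iff]
  exact ite_abs_coe_sub σ τ

namespace IsCurve

variable {I F : Set (Pt 2)} {T : Set ℝ} {p : ℝ → EReal}

/-- A real diagonal meets the boundary in a single point of real height, so the infimum has only one
term. -/
theorem dl_diagPt (h : IsCurve I F T p) {t τ : ℝ} (ht : t ∈ T) (hτ : p t = τ) (σ : ℝ) :
    dl (diagPt t σ) F = ENNReal.ofReal |σ - τ| := by
  refine le_antisymm ?_ (le_iInf₂ ?_)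
  · rw [← distInf_diagPt t σ τ]
    refine iInf₂_le _ ⟨⟨τ - σ, ?_⟩, h.diag_mem t τ ht hτ⟩
    rw [translate_diagPt]
    congr 2
    ring
  · rintro y ⟨⟨a, rfl⟩, hy⟩
    rw [translate_diagPt] at hy ⊢
    have := (h.diag_eq _ _ hy).2
    rw [hτ, EReal.coe_eq_coe_iff] at this
    rw [distInf_diagPt, this]

/-- The diagonal through a point with abscissa `⊥` stays at `⊥`, and it may meet `F` in a whole
segment. By `left_end` the height `τ` is the lowest real one there, hence the nearest when seen from
below. -/
theorem dl_left (h : IsCurve I F T p) {t τ σ : ℝ} (hx : diagPt t τ ∈ F)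
    (hy : ![⊥, (τ : EReal)] ∈ F) (hσ : σ ≤ τ) :
    dl ![⊥, (σ : EReal)] F = ENNReal.ofReal |σ - τ| := by
  refine le_antisymm ?_ (le_iInf₂ ?_)
  · rw [← distInf_left σ τ]
    refine iInf₂_le _ ⟨⟨τ - σ, ?_⟩, hy⟩
    rw [translate_left]
    congr 4
    ring
  · rintro y ⟨⟨a, rfl⟩, hy'⟩
    rw [translate_left] at hy' ⊢
    have := h.left_end _ _ _ hx hy hy'
    rw [distInf_left]
    refine ENNReal.ofReal_le_ofReal ?_
    rw [abs_of_nonpos (by linarith), abs_of_nonpos (by linarith)]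
    linarith

theorem dl_bottom (h : IsCurve I F T p) {t τ σ : ℝ} (hx : diagPt t τ ∈ F)
    (hy : ![((t + τ : ℝ) : EReal), ⊥] ∈ F) (hσ : σ ≤ τ) :
    dl ![((t + σ : ℝ) : EReal), ⊥] F = ENNReal.ofReal |σ - τ| := by
  refine le_antisymm ?_ (le_iInf₂ ?_)
  · rw [← add_sub_add_left_eq_sub σ τ t, ← distInf_bottom]
    refine iInf₂_le _ ⟨⟨τ - σ, ?_⟩, hy⟩
    rw [translate_bottom]
    congr 2
    ring_nf
  · rintro y ⟨⟨a, rfl⟩, hy'⟩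
    rw [translate_bottom] at hy' ⊢
    have := h.bottom_end _ _ _ hx hy hy'
    rw [distInf_bottom]
    refine ENNReal.ofReal_le_ofReal ?_
    rw [abs_of_nonpos (by linarith), abs_of_nonpos (by linarith)]
    linarith

/-- Two boundary curves, at a common diagonal: either their distance is the diagonal distance from a
vertex to one of them, or the difference of the curves has slope `1` or `-1` there. -/
theorem dl_vertex_or_slope {J G : Set (Pt 2)} {S : Set ℝ} {q : ℝ → EReal} (h : IsCurve I F T p)
    (h' : IsCurve J G S q) {t σ τ : ℝ} (ht : t ∈ T) (ht' : t ∈ S) (hσ : p t = σ) (hτ : q t = τ) :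
    (∃ x ∈ vertices I, dl x G = ENNReal.ofReal |σ - τ|) ∨
    (∃ x ∈ vertices J, dl x F = ENNReal.ofReal |σ - τ|) ∨
    (T ∩ S ∈ 𝓝 t ∧ ∃ ε : ℝ, (ε = 1 ∨ ε = -1) ∧ ∀ᶠ s in 𝓝 t, ∃ a b : ℝ, p s = a ∧ q s = b ∧
      a - b = σ - τ + ε * (s - t)) := by
  rcases h.vertex_or_affine ht hσ with hv | ⟨hT, hp⟩
  · exact Or.inl ⟨_, hv, h'.dl_diagPt ht' hτ σ⟩
  rcases h'.vertex_or_affine ht' hτ with hv | ⟨hS, hq⟩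
  · exact Or.inr (Or.inl ⟨_, hv, by rw [h.dl_diagPt ht hσ τ, abs_sub_comm]⟩)
  rcases hp with hp | hp <;> rcases hq with hq | hq
  -- Two horizontal edges: slide left, keeping the difference of heights, until one of them ends. If
  -- both run to `⊥`, the lower end point is taken as the vertex, so that the other boundary is seen
  -- from below.
  · rcases h.horizontal_end hT hp with ⟨t₁, ht₁, hv₁, H₁⟩ | ⟨hv₁, hF, hz, H₁⟩ <;>
      rcases h'.horizontal_end hS hq with ⟨t₂, ht₂, hv₂, H₂⟩ | ⟨hv₂, hG, hz', H₂⟩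
    · rcases le_total t₁ t₂ with hle | hle
      · obtain ⟨h1, h2⟩ := H₁ t₂ hle ht₂
        exact Or.inr (Or.inl ⟨_, hv₂, by rw [h.dl_diagPt h1 h2 τ, abs_sub_comm]⟩)
      · obtain ⟨h1, h2⟩ := H₂ t₁ hle ht₁
        exact Or.inl ⟨_, hv₁, h'.dl_diagPt h1 h2 σ⟩
    · obtain ⟨h1, h2⟩ := H₂ t₁ ht₁
      exact Or.inl ⟨_, hv₁, h'.dl_diagPt h1 h2 σ⟩
    · obtain ⟨h1, h2⟩ := H₁ t₂ ht₂
      exact Or.inr (Or.inl ⟨_, hv₂, by rw [h.dl_diagPt h1 h2 τ, abs_sub_comm]⟩)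
    · rcases le_total σ τ with hle | hle
      · exact Or.inl ⟨_, hv₁, h'.dl_left hz' hG hle⟩
      · exact Or.inr (Or.inl ⟨_, hv₂, by rw [h.dl_left hz hF hle, abs_sub_comm]⟩)
  · refine Or.inr (Or.inr ⟨inter_mem hT hS, 1, Or.inl rfl, ?_⟩)
    filter_upwards [hp, hq] with s h1 h2
    exact ⟨_, _, h1, h2, by ring⟩
  · refine Or.inr (Or.inr ⟨inter_mem hT hS, -1, Or.inr rfl, ?_⟩)
    filter_upwards [hp, hq] with s h1 h2
    exact ⟨_, _, h1, h2, by ring⟩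
  -- Two vertical edges: the same argument, sliding down.
  · have e : ∀ s : ℝ, |t + σ - s - (t + τ - s)| = |σ - τ| := fun s => by congr 1; ring
    have e' : ∀ s : ℝ, |t + τ - s - (t + σ - s)| = |σ - τ| := fun s => by
      rw [abs_sub_comm σ]; congr 1; ring
    rcases h.vertical_end hT hp with ⟨t₁, ht₁, hv₁, H₁⟩ | ⟨hv₁, hF, hz, H₁⟩ <;>
      rcases h'.vertical_end hS hq with ⟨t₂, ht₂, hv₂, H₂⟩ | ⟨hv₂, hG, hz', H₂⟩
    · rcases le_total t₁ t₂ with hle | hle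
      · obtain ⟨h1, h2⟩ := H₂ t₁ ht₁ hle
        exact Or.inl ⟨_, hv₁, by rw [h'.dl_diagPt h1 h2, e]⟩
      · obtain ⟨h1, h2⟩ := H₁ t₂ ht₂ hle
        exact Or.inr (Or.inl ⟨_, hv₂, by rw [h.dl_diagPt h1 h2, e']⟩)
    · obtain ⟨h1, h2⟩ := H₂ t₁ ht₁
      exact Or.inl ⟨_, hv₁, by rw [h'.dl_diagPt h1 h2, e]⟩
    · obtain ⟨h1, h2⟩ := H₁ t₂ ht₂
      exact Or.inr (Or.inl ⟨_, hv₂, by rw [h.dl_diagPt h1 h2, e']⟩)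
    · rcases le_total σ τ with hle | hle
      · exact Or.inl ⟨_, hv₁, h'.dl_bottom hz' hG hle⟩
      · exact Or.inr (Or.inl ⟨_, hv₂, by rw [h.dl_bottom hz hF hle, abs_sub_comm]⟩)

end IsCurve

/-! ### Differences of staircase functions -/

theorem add_le_of_le_sub {p q : EReal} {c : ℝ} (h : (c : EReal) ≤ p - q) : q + c ≤ p := by
  induction p <;> induction q <;> try simp_all
  norm_cast at *
  linarith

theorem add_lt_of_lt_sub {p q : EReal} {c : ℝ} (h : (c : EReal) < p - q) : q + c < p := by
  induction p <;> induction q <;> try simp_all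
  · norm_cast at *
    linarith
  · exact EReal.coe_lt_top _

theorem le_add_of_not_le_sub {p q : EReal} {c : ℝ} (h : ¬ (c : EReal) ≤ p - q) : p ≤ q + c := by
  induction p <;> induction q <;> try simp_all
  norm_cast at *
  linarith

/-- In `EReal` both `⊤ - ⊤` and `⊥ - ⊥` are `⊥`. The two side conditions exclude these cases; the
other translations between sums and differences need no such care. -/
theorem le_sub_of_add_le {p q : EReal} {c : ℝ} (hp : p ≠ ⊥) (hq : q ≠ ⊤) (h : q + c ≤ p) :
    (c : EReal) ≤ p - q := by
  induction p <;> induction q <;> try simp_all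
  norm_cast at *
  linarith

theorem exists_coe_of_sub_eq_coe {p q : EReal} {c : ℝ} (h : p - q = c) :
    ∃ a b : ℝ, p = a ∧ q = b ∧ a - b = c := by
  induction p <;> induction q <;> try simp_all
  norm_cast at *

/-- Monotonicity and the slope bound spread an infinite value to all of `ℝ`. -/
theorem IsStair.top_or_bot_or_real {p : ℝ → EReal} (h : IsStair p) :
    (∀ t, p t = ⊤) ∨ (∀ t, p t = ⊥) ∨ ∃ f : ℝ → ℝ, Continuous f ∧ ∀ t, p t = f t := by
  by_cases h1 : ∃ t, p t = ⊤
  · left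
    obtain ⟨t, ht⟩ := h1
    intro s
    rcases le_total s t with hs | hs
    · exact top_le_iff.1 (ht ▸ h.anti hs)
    · have := h.lip t s hs
      rw [ht, top_le_iff] at this
      by_contra hne
      exact (EReal.add_lt_top hne (EReal.coe_ne_top _)).ne this
  by_cases h2 : ∃ t, p t = ⊥
  · right; left
    obtain ⟨t, ht⟩ := h2
    intro s
    rcases le_total s t with hs | hs
    · have := h.lip s t hs
      rwa [ht, EReal.bot_add, le_bot_iff] at this
    · exact le_bot_iff.1 (ht ▸ h.anti hs)
  right; right
  push Not at h1 h2
  have e : ∀ t, p t = ((p t).toReal : ℝ) := fun t => (EReal.coe_toReal (h1 t) (h2 t)).symm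
  refine ⟨fun t => (p t).toReal, ?_, e⟩
  rw [EReal.isEmbedding_coe.continuous_iff]
  exact h.cont.congr e

/-- Subtraction of extended reals is not continuous everywhere, but a staircase is finite everywhere
or constantly infinite. -/
theorem IsStair.continuous_sub {p q : ℝ → EReal} (hp : IsStair p) (hq : IsStair q) :
    Continuous fun t => p t - q t := by
  rcases hp.top_or_bot_or_real with hp | hp | ⟨f, hf, hp⟩ <;>
    rcases hq.top_or_bot_or_real with hq | hq | ⟨g, hg, hq⟩ <;> simp only [hp, hq]
  any_goals first | exact continuous_const | (simp; exact continuous_const)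
  · simp only [← EReal.coe_sub]
    exact continuous_coe_real_ereal.comp (hf.sub hg)

/-! ### Functions without critical values -/

/-- On the set `D`, the function `f` has slope `1` or `-1` wherever its value is in `[a, b]`. -/
structure IsRegular (f : ℝ → EReal) (D : Set ℝ) (a b : ℝ) : Prop where
  cont : Continuous f
  slope : ∀ t ∈ D, ∀ c : ℝ, f t = c → a ≤ c → c ≤ b → ∃ ε : ℝ, (ε = 1 ∨ ε = -1) ∧
    ∀ᶠ s in 𝓝 t, s ∈ D ∧ f s = ((c + ε * (s - t) : ℝ) : EReal)

namespace IsRegular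

variable {f : ℝ → EReal} {D : Set ℝ} {a b : ℝ}

theorem coe_between {x : EReal} (h₁ : (a : EReal) ≤ x) (h₂ : x < b) :
    ∃ c : ℝ, x = c ∧ a ≤ c ∧ c < b := by
  induction x
  · simp at h₁
  · exact ⟨_, rfl, EReal.coe_le_coe_iff.1 h₁, EReal.coe_lt_coe_iff.1 h₂⟩
  · simp at h₂

/-- Continuous induction in the uphill direction `ε`: the set reached so far is closed, and at a
value below `b` regularity extends it a little further. -/
theorem ascend_aux (h : IsRegular f D a b) (hD : IsClosed D) {t c ε : ℝ} (hε : ε = 1 ∨ ε = -1)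
    (hac : a ≤ c)
    (hloc : ∀ᶠ s in 𝓝 t, s ∈ D ∧ f s = ((c + ε * (s - t) : ℝ) : EReal)) :
    ∀ x ∈ Set.Icc 0 (b - c), t + ε * x ∈ D ∧ f (t + ε * x) = ((c + x : ℝ) : EReal) := by
  have hεε : ε * ε = 1 := by rcases hε with rfl | rfl <;> norm_num
  let P : Set ℝ := {x | t + ε * x ∈ D ∧ f (t + ε * x) = ((c + x : ℝ) : EReal)}
  have hP : IsClosed P := (hD.preimage (by fun_prop)).inter
    (isClosed_eq (h.cont.comp (by fun_prop)) (continuous_coe_real_ereal.comp (by fun_prop)))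
  -- The factor `θ` makes this the set of `x` for which the whole segment from `0` to `x` has been
  -- covered.
  let S : Set ℝ := {x | ∀ θ ∈ Set.Icc (0 : ℝ) 1, θ * x ∈ P}
  have hS : IsClosed S := by
    have : S = ⋂ θ ∈ Set.Icc (0 : ℝ) 1, (fun x => θ * x) ⁻¹' P := by
      ext x; simp [S]
    rw [this]
    exact isClosed_biInter fun θ _ => hP.preimage (by fun_prop)
  have h0 : (0 : ℝ) ∈ S := by
    intro θ _
    rw [mul_zero]
    simpa [P] using hloc.self_of_nhds
  have main : Set.Icc 0 (b - c) ⊆ S := by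
    refine (hS.inter isClosed_Icc).Icc_subset_of_forall_exists_gt h0 ?_
    rintro x ⟨hx, hx0, hxb⟩ y (hy : x < y)
    have hxP : x ∈ P := by simpa using hx 1 (by simp)
    have hslope : ∀ᶠ s in 𝓝 (t + ε * x), s ∈ D ∧
        f s = ((c + x + ε * (s - (t + ε * x)) : ℝ) : EReal) := by
      obtain ⟨ε', hε', hloc'⟩ := h.slope _ hxP.1 _ hxP.2 (by linarith) (by linarith)
      rcases hx0.eq_or_lt with rfl | hxpos
      · simpa using hloc
      -- The slope cannot turn at `x`: just before `x` the function is already known to have slope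
      -- `ε`.
      · suffices ε' = ε by rwa [this] at hloc'
        have ht : Tendsto (fun θ : ℝ => t + ε * (θ * x)) (𝓝[<] 1) (𝓝 (t + ε * x)) := by
          have : Tendsto (fun θ : ℝ => t + ε * (θ * x)) (𝓝 1) (𝓝 (t + ε * (1 * x))) :=
            (by fun_prop : Continuous fun θ : ℝ => t + ε * (θ * x)).tendsto 1
          rw [one_mul] at this
          exact this.mono_left nhdsWithin_le_nhds
        obtain ⟨θ, hθ1, hθ2⟩ := ((ht.eventually hloc').and
          (Ioo_mem_nhdsLT (show (0 : ℝ) < 1 by norm_num))).exists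
        have := (hx θ ⟨hθ2.1.le, hθ2.2.le⟩).2
        rw [hθ1.2, EReal.coe_eq_coe_iff] at this
        have h1 : (θ - 1) * x * (ε' * ε - 1) = 0 := by linear_combination this
        have h2 : (θ - 1) * x ≠ 0 := mul_ne_zero (by linarith [hθ2.2]) hxpos.ne'
        have h3 := (mul_eq_zero.1 h1).resolve_left h2
        linear_combination ε * h3 - ε' * hεε
    obtain ⟨η, hη, hball⟩ := Metric.eventually_nhds_iff.1 hslope
    refine ⟨min y (x + η / 2), fun θ hθ => ?_, lt_min hy (by linarith), min_le_left _ _⟩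
    set z := min y (x + η / 2) with hz
    have hzx : x < z := lt_min hy (by linarith)
    rcases le_total (θ * z) x with hle | hle
    · rcases hx0.eq_or_lt with rfl | hxpos
      · have : θ * z = 0 := le_antisymm hle (mul_nonneg hθ.1 hzx.le)
        rw [this]
        exact hxP
      · have := hx (θ * z / x) ⟨div_nonneg (mul_nonneg hθ.1 (hx0.trans hzx.le)) hx0,
          (div_le_one hxpos).2 hle⟩
        rwa [div_mul_cancel₀ _ hxpos.ne'] at this
    · have hzη : z ≤ x + η / 2 := min_le_right _ _
      have hθz : θ * z ≤ z := mul_le_of_le_one_left (hx0.trans hzx.le) hθ.2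
      have hd : dist (t + ε * (θ * z)) (t + ε * x) < η := by
        rw [Real.dist_eq, show t + ε * (θ * z) - (t + ε * x) = ε * (θ * z - x) by ring, abs_mul,
          show |ε| = 1 by rcases hε with rfl | rfl <;> simp, one_mul, abs_of_nonneg (by linarith)]
        linarith
      refine ⟨(hball hd).1, (hball hd).2.trans ?_⟩
      congr 1
      linear_combination (θ * z - x) * hεε
  intro x hx
  have : x ∈ P := by simpa using main hx 1 (by simp)
  exact this

/-- From a value in `[a, b]` one can ascend to the value `b`. -/
theorem ascend (h : IsRegular f D a b) (hD : IsClosed D) {t : ℝ} (ht : t ∈ D)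
    (hf : (a : EReal) ≤ f t) :
    ∃ t' ∈ D, (b : EReal) ≤ f t' ∧ ∀ s ∈ Set.uIcc t t', s ∈ D ∧ (a : EReal) ≤ f s := by
  rcases le_or_gt (b : EReal) (f t) with hb | hb
  · refine ⟨t, ht, hb, fun s hs => ?_⟩
    rw [Set.uIcc_self, Set.mem_singleton_iff] at hs
    exact hs ▸ ⟨ht, hf⟩
  obtain ⟨c, hc, hac, hcb⟩ := coe_between hf hb
  obtain ⟨ε, hε, hloc⟩ := h.slope t ht c hc hac hcb.le
  have key := h.ascend_aux hD hε hac hloc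
  have hεε : ε * ε = 1 := by rcases hε with rfl | rfl <;> norm_num
  obtain ⟨h1, h2⟩ := key (b - c) ⟨by linarith, le_rfl⟩
  refine ⟨_, h1, by rw [h2, add_sub_cancel], fun s hs => ?_⟩
  have hs' : ε * (s - t) ∈ Set.Icc 0 (b - c) := by
    rcases hε with rfl | rfl
    · rw [Set.uIcc_of_le (by linarith)] at hs
      constructor <;> linarith [hs.1, hs.2]
    · rw [Set.uIcc_of_ge (by linarith)] at hs
      constructor <;> linarith [hs.1, hs.2]
  obtain ⟨h3, h4⟩ := key _ hs'
  rw [show t + ε * (ε * (s - t)) = s by linear_combination (s - t) * hεε] at h3 h4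
  exact ⟨h3, by rw [h4, EReal.coe_le_coe_iff]; linarith [hs'.1]⟩

/-- There is no interior minimum with value in `[a, b)`. -/
theorem le_of_ends (h : IsRegular f D a b) {r t : ℝ}
    (hrt : ∀ s ∈ Set.uIcc r t, s ∈ D ∧ (a : EReal) ≤ f s) (hr : (b : EReal) ≤ f r)
    (ht : (b : EReal) ≤ f t) : ∀ s ∈ Set.uIcc r t, (b : EReal) ≤ f s := by
  -- A minimum below `b` would be interior, and there the slope is `1` or `-1`.
  obtain ⟨m, hm, hmin⟩ := isCompact_uIcc.exists_isMinOn Set.nonempty_uIcc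
    (h.cont.continuousOn (s := Set.uIcc r t))
  refine fun s hs => le_trans (not_lt.1 fun hlt => ?_) (hmin hs)
  obtain ⟨c, hc, hac, hcb⟩ := coe_between (hrt m hm).2 hlt
  obtain ⟨ε, hε, hloc⟩ := h.slope m (hrt m hm).1 c hc hac hcb.le
  have hmr : m ≠ r := fun e => hr.not_gt (e ▸ hlt)
  have hmt : m ≠ t := fun e => ht.not_gt (e ▸ hlt)
  have hint : Set.uIcc r t ∈ 𝓝 m := by
    rcases le_total r t with hle | hle
    · rw [Set.uIcc_of_le hle] at hm ⊢
      exact Icc_mem_nhds (lt_of_le_of_ne hm.1 hmr.symm) (lt_of_le_of_ne hm.2 hmt)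
    · rw [Set.uIcc_of_ge hle] at hm ⊢
      exact Icc_mem_nhds (lt_of_le_of_ne hm.1 hmt.symm) (lt_of_le_of_ne hm.2 hmr)
  have low : ∀ s, s ∈ Set.uIcc r t → f s = ((c + ε * (s - m) : ℝ) : EReal) →
      ε * (s - m) < 0 → False := fun s hs h1 h2 => by
    have := hmin hs
    rw [Set.mem_ofPred_eq, hc, h1, EReal.coe_le_coe_iff] at this
    linarith
  rcases hε with rfl | rfl
  · obtain ⟨s, ⟨h1, h2⟩, h3⟩ := (((hloc.and (show ∀ᶠ s in 𝓝 m, s ∈ Set.uIcc r t from hint)).filter_mono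
      (nhdsWithin_le_nhds (s := Set.Iio m))).and (eventually_mem_nhdsWithin)).exists
    exact low s h2 h1.2 (by linarith [show s < m from h3])
  · obtain ⟨s, ⟨h1, h2⟩, h3⟩ := (((hloc.and (show ∀ᶠ s in 𝓝 m, s ∈ Set.uIcc r t from hint)).filter_mono
      (nhdsWithin_le_nhds (s := Set.Ioi m))).and (eventually_mem_nhdsWithin)).exists
    exact low s h2 h1.2 (by linarith [show m < s from h3])

/-- Here `g` is the room along a path and `f` the quantity required at its end. Extend the path by
climbing along `f` up to `b`. Since `f ≤ g`, the room stays at least `a` and is at least `b` at both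
ends, hence everywhere by `le_of_ends`. -/
theorem ascend_path {g : ℝ → EReal} (h : IsRegular f D a b) (hg : IsRegular g D a b)
    (hD : IsClosed D) (hD' : D.OrdConnected) (hle : ∀ s ∈ D, f s ≤ g s) {r t : ℝ} (hr : r ∈ D)
    (ht : t ∈ D) (hrt : ∀ s ∈ Set.uIcc r t, (a : EReal) ≤ g s) (hgr : (b : EReal) ≤ g r)
    (hft : (a : EReal) ≤ f t) :
    ∃ t', (∀ s ∈ Set.uIcc r t', (b : EReal) ≤ g s) ∧ (b : EReal) ≤ f t' := by
  obtain ⟨t', ht', hb, hpath⟩ := h.ascend hD ht hft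
  refine ⟨t', hg.le_of_ends (fun s hs => ⟨hD'.uIcc_subset hr ht' hs, ?_⟩) hgr
    (hb.trans (hle _ ht')), hb⟩
  rcases Set.uIcc_subset_uIcc_union_uIcc (b := t) hs with hs | hs
  · exact hrt s hs
  · exact (hpath s hs).2.trans (hle s (hpath s hs).1)

/-- Positivity of `a` removes the absolute value from the diagonal distance, so a locally constant
difference would be an excluded value. -/
theorem _root_.BiPersistence.IsCurve.isRegular_sub {I F J G : Set (Pt 2)} {T S : Set ℝ}
    {p q : ℝ → EReal} (h : IsCurve I F T p) (h' : IsCurve J G S q) (ha : 0 < a)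
    (hcrit : ∀ c : ℝ, a ≤ c → c ≤ b → ∀ x ∈ vertices I ∪ vertices J,
      dl x F ≠ ENNReal.ofReal c ∧ dl x G ≠ ENNReal.ofReal c) :
    IsRegular (fun t => p t - q t) (T ∩ S) a b where
  cont := h.stair.continuous_sub h'.stair
  slope t ht c hc hac hcb := by
    obtain ⟨σ, τ, hσ, hτ, rfl⟩ := exists_coe_of_sub_eq_coe hc
    have habs : |σ - τ| = σ - τ := abs_of_nonneg (by linarith)
    rcases h.dl_vertex_or_slope h' ht.1 ht.2 hσ hτ with ⟨x, hx, e⟩ | ⟨x, hx, e⟩ | ⟨hn, ε, hε, hs⟩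
    · rw [habs] at e
      exact absurd e (hcrit _ hac hcb x (Or.inl hx)).2
    · rw [habs] at e
      exact absurd e (hcrit _ hac hcb x (Or.inr hx)).1
    · refine ⟨ε, hε, ?_⟩
      filter_upwards [hn, hs] with s h1 ⟨a, b, h2, h3, h4⟩
      exact ⟨h1, by rw [h2, h3, ← h4, EReal.coe_sub]⟩

end IsRegular

/-! ### Obstructions to interleavings along the family of diagonals -/

/-- The diagonal of `t` can be reached from the one of `t₀` through diagonals on which the interval
between `l` and the `δ`-shift of `u'` is nonempty, and there `l'` or `u'`, shifted by `δ`, is above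
`l` or `u`, respectively. -/
def ObstructedPath (l u l' u' : ℝ → EReal) (δ t₀ : ℝ) : Prop :=
  ∃ t, (∀ s ∈ Set.uIcc t₀ t, (δ : EReal) ≤ u' s - l s) ∧
    ((δ : EReal) ≤ l' t - l t ∨ (δ : EReal) ≤ u' t - u t)

/-- The two bars on the diagonal of `t` have end points at distance `δ` or more. -/
def FarAt (l u l' u' : ℝ → EReal) (δ t : ℝ) : Prop :=
  ((δ : EReal) ≤ l' t - l t ∨ (δ : EReal) ≤ u' t - u t) ∨
    ((δ : EReal) ≤ l t - l' t ∨ (δ : EReal) ≤ u t - u' t)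

/-- On some diagonal, one of the two bars has length `2 * δ` or more, and there is an obstruction
to a `δ`-interleaving that is nonzero on this diagonal. -/
def Obstructed (l u l' u' : ℝ → EReal) (δ : ℝ) : Prop :=
  ∃ t, (((2 * δ : ℝ) : EReal) ≤ u t - l t ∨ ((2 * δ : ℝ) : EReal) ≤ u' t - l' t) ∧
    (FarAt l u l' u' δ t ∨ ObstructedPath l u l' u' δ t ∨ ObstructedPath l' u' l u δ t)

section

variable {l u l' u' : ℝ → EReal} {δ δ' : ℝ}

theorem farAt_comm {t : ℝ} (h : FarAt l u l' u' δ t) : FarAt l' u' l u δ t := h.symm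

theorem Obstructed.symm (h : Obstructed l u l' u' δ) : Obstructed l' u' l u δ := by
  obtain ⟨t, h1, h2⟩ := h
  exact ⟨t, h1.symm, h2.imp farAt_comm Or.symm⟩

theorem add_two_mul (x : EReal) (δ : ℝ) : x + ((2 * δ : ℝ) : EReal) = x + δ + δ := by
  rw [two_mul, EReal.coe_add, add_assoc]

theorem le_of_coe_add_le {x y : EReal} (hδ : 0 ≤ δ) (h : x + δ ≤ y) : x ≤ y :=
  (le_add_of_nonneg_right (EReal.coe_nonneg.2 hδ)).trans h

theorem add_coe_le_add_coe_iff {x y : EReal} : x + (δ : EReal) ≤ y + δ ↔ x ≤ y :=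
  ⟨fun h => by
    have := add_le_add_left h ((-δ : ℝ) : EReal)
    rwa [add_assoc, add_assoc, ← EReal.coe_add, add_neg_cancel, EReal.coe_zero, add_zero,
      add_zero] at this, fun h => add_le_add_left h _⟩

/-- The consequences of a long bar of the first interval on a diagonal where the bars are close. -/
theorem close_of_not_farAt {t : ℝ} (hlen : ((2 * δ : ℝ) : EReal) ≤ u t - l t)
    (h : ¬ FarAt l u l' u' δ t) : l t + δ ≤ u' t ∧ l' t + δ ≤ u t ∧ l' t ≤ u' t := by
  simp only [FarAt, not_or] at h
  obtain ⟨⟨h1, -⟩, h3, h4⟩ := h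
  have h1 := le_add_of_not_le_sub h1
  have h4 := le_add_of_not_le_sub h4
  have h0 := add_le_of_le_sub hlen
  rw [add_two_mul] at h0
  have h5 : l t + δ ≤ u' t := add_coe_le_add_coe_iff.1 (h0.trans h4)
  exact ⟨h5, (add_le_add_left h1 _).trans h0, h1.trans h5⟩

theorem exists_first_hit {Z : Set ℝ} (hZ : IsClosed Z) {a b : ℝ}
    (h : ∃ s ∈ Set.uIcc a b, s ∈ Z) :
    ∃ c ∈ Set.uIcc a b, c ∈ Z ∧ ∀ s ∈ Set.uIcc a c, s ≠ c → s ∉ Z := by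
  obtain ⟨c, ⟨hc, hcZ⟩, hmin⟩ := (isCompact_uIcc.inter_right hZ).exists_isMinOn h
    (f := fun s => |s - a|) (by fun_prop)
  refine ⟨c, hc, hcZ, fun s hs hsc hsZ => hsc ?_⟩
  have h1 : |c - a| ≤ |s - a| := hmin ⟨Set.uIcc_subset_uIcc_left hc hs, hsZ⟩
  rcases le_total a c with h | h
  · rw [Set.uIcc_of_le h] at hs
    rw [abs_of_nonneg (by linarith), abs_of_nonneg (by linarith [hs.1])] at h1
    linarith [hs.2]
  · rw [Set.uIcc_of_ge h] at hs
    rw [abs_of_nonpos (by linarith), abs_of_nonpos (by linarith [hs.2])] at h1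
    linarith [hs.1]

theorem mem_of_forall_ne_mem {D : Set ℝ} (hD : IsClosed D) {a c : ℝ} (ha : a ∈ D)
    (h : ∀ s ∈ Set.uIcc a c, s ≠ c → s ∈ D) : c ∈ D := by
  by_cases hac : a = c
  · exact hac ▸ ha
  refine hD.closure_subset (closure_mono (s := Set.uIoo a c) (fun s hs => ?_) ?_)
  · refine h s (Set.uIoo_subset_uIcc_self hs) ?_
    rintro rfl
    simp at hs
  · rw [closure_uIoo hac]
    exact Set.right_mem_uIcc

/-- The differences of four staircase functions have no critical values in the range that is
relevant for the parameters from `δ` to `δ'`. -/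
structure IsGeneric (l u l' u' : ℝ → EReal) (δ δ' : ℝ) : Prop where
  lower : ∀ t, l t ≠ ⊤ ∧ l' t ≠ ⊤
  upper : ∀ t, u t ≠ ⊥ ∧ u' t ≠ ⊥
  dom : IsClosed {t | l t ≤ u t} ∧ Set.OrdConnected {t | l t ≤ u t}
  dom' : IsClosed {t | l' t ≤ u' t} ∧ Set.OrdConnected {t | l' t ≤ u' t}
  length : IsRegular (fun t => u t - l t) {t | l t ≤ u t} (2 * δ) (2 * δ')
  length' : IsRegular (fun t => u' t - l' t) {t | l' t ≤ u' t} (2 * δ) (2 * δ')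
  lowers : IsRegular (fun t => l' t - l t) ({t | l t ≤ u t} ∩ {t | l' t ≤ u' t}) δ δ'
  lowers' : IsRegular (fun t => l t - l' t) ({t | l t ≤ u t} ∩ {t | l' t ≤ u' t}) δ δ'
  uppers : IsRegular (fun t => u' t - u t) ({t | l t ≤ u t} ∩ {t | l' t ≤ u' t}) δ δ'
  uppers' : IsRegular (fun t => u t - u' t) ({t | l t ≤ u t} ∩ {t | l' t ≤ u' t}) δ δ'
  mixed : IsRegular (fun t => u' t - l t) ({t | l t ≤ u t} ∩ {t | l' t ≤ u' t}) δ δ'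
  mixed' : IsRegular (fun t => u t - l' t) ({t | l t ≤ u t} ∩ {t | l' t ≤ u' t}) δ δ'

theorem IsGeneric.symm (h : IsGeneric l u l' u' δ δ') : IsGeneric l' u' l u δ δ' where
  lower t := (h.lower t).symm
  upper t := (h.upper t).symm
  dom := h.dom'
  dom' := h.dom
  length := h.length'
  length' := h.length
  lowers := Set.inter_comm _ _ ▸ h.lowers'
  lowers' := Set.inter_comm _ _ ▸ h.lowers
  uppers := Set.inter_comm _ _ ▸ h.uppers'
  uppers' := Set.inter_comm _ _ ▸ h.uppers
  mixed := Set.inter_comm _ _ ▸ h.mixed'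
  mixed' := Set.inter_comm _ _ ▸ h.mixed

theorem IsGeneric.isClosed_pathEnd (h : IsGeneric l u l' u' δ δ') :
    IsClosed {t | (δ : EReal) ≤ l' t - l t ∨ (δ : EReal) ≤ u' t - u t} :=
  (isClosed_le continuous_const h.lowers.cont).union (isClosed_le continuous_const h.uppers.cont)

theorem IsGeneric.isClosed_farAt (h : IsGeneric l u l' u' δ δ') :
    IsClosed {t | FarAt l u l' u' δ t} :=
  h.isClosed_pathEnd.union h.symm.isClosed_pathEnd

/-- A path that ends in the common domain of the two intervals. -/
def InnerPath (l u l' u' : ℝ → EReal) (δ t₀ : ℝ) : Prop :=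
  ∃ t, l t ≤ u t ∧ l' t ≤ u' t ∧ (∀ s ∈ Set.uIcc t₀ t, (δ : EReal) ≤ u' s - l s) ∧
    ((δ : EReal) ≤ l' t - l t ∨ (δ : EReal) ≤ u' t - u t)

/-- Stop at the first diagonal where the end condition holds. Before it, `l' ≤ l + δ ≤ u' ≤ u + δ`,
so both bars are nonempty; closedness of the domains covers the last diagonal. -/
theorem IsGeneric.innerPath_of_path (h : IsGeneric l u l' u' δ δ') {t₀ : ℝ}
    (ht : l t₀ ≤ u t₀) (ht' : l' t₀ ≤ u' t₀) (hp : ObstructedPath l u l' u' δ t₀) :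
    InnerPath l u l' u' δ t₀ := by
  obtain ⟨t, hpath, hend⟩ := hp
  obtain ⟨c, hc, hcZ, hfirst⟩ := exists_first_hit h.isClosed_pathEnd ⟨t, Set.right_mem_uIcc, hend⟩
  have hsub := Set.uIcc_subset_uIcc_left hc
  have inner : ∀ s ∈ Set.uIcc t₀ c, s ≠ c → l s ≤ u s ∧ l' s ≤ u' s := by
    intro s hs hsc
    have h0 := hfirst s hs hsc
    simp only [Set.mem_ofPred_eq, not_or] at h0
    have h1 := le_add_of_not_le_sub h0.1
    have h2 := le_add_of_not_le_sub h0.2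
    have h3 := add_le_of_le_sub (hpath s (hsub hs))
    exact ⟨add_coe_le_add_coe_iff.1 (h3.trans h2), h1.trans h3⟩
  exact ⟨c, mem_of_forall_ne_mem h.dom.1 ht fun s hs hsc => (inner s hs hsc).1,
    mem_of_forall_ne_mem h.dom'.1 ht' fun s hs hsc => (inner s hs hsc).2,
    fun s hs => hpath s (hsub hs), hcZ⟩

theorem IsGeneric.obstructedPath_of_innerPath (h : IsGeneric l u l' u' δ δ') {t₀ : ℝ}
    (ht : l t₀ ≤ u t₀) (ht' : l' t₀ ≤ u' t₀) (hm : (δ' : EReal) ≤ u' t₀ - l t₀)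
    (hp : InnerPath l u l' u' δ t₀) : ObstructedPath l u l' u' δ' t₀ := by
  obtain ⟨t, h1, h2, hpath, hend | hend⟩ := hp
  · obtain ⟨t', h3, h4⟩ := h.lowers.ascend_path h.mixed (h.dom.1.inter h.dom'.1)
      (h.dom.2.inter h.dom'.2) (fun s hs => EReal.sub_le_sub hs.2 le_rfl) ⟨ht, ht'⟩ ⟨h1, h2⟩ hpath
      hm hend
    exact ⟨t', h3, Or.inl h4⟩
  · obtain ⟨t', h3, h4⟩ := h.uppers.ascend_path h.mixed (h.dom.1.inter h.dom'.1)
      (h.dom.2.inter h.dom'.2) (fun s hs => EReal.sub_le_sub le_rfl hs.1) ⟨ht, ht'⟩ ⟨h1, h2⟩ hpath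
      hm hend
    exact ⟨t', h3, Or.inr h4⟩

/-- Climb along the length of the first bar until it is `2 * δ'`, at the diagonal `r`. If the bars
are not far apart there, the old obstruction is connected to `r` by a path with enough room, and
then enlarged from `δ` to `δ'`. -/
theorem IsGeneric.obstructed_aux (h : IsGeneric l u l' u' δ δ') (hδ : 0 ≤ δ) {t : ℝ}
    (hlen : ((2 * δ : ℝ) : EReal) ≤ u t - l t)
    (hobs : FarAt l u l' u' δ t ∨ ObstructedPath l u l' u' δ t ∨ ObstructedPath l' u' l u δ t) :
    Obstructed l u l' u' δ' := by
  have ht : l t ≤ u t := le_of_coe_add_le (by linarith) (add_le_of_le_sub hlen)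
  obtain ⟨r, hr, hrlen, hpath⟩ := h.length.ascend h.dom.1 ht hlen
  refine ⟨r, Or.inl hrlen, ?_⟩
  by_cases hfar : FarAt l u l' u' δ' r
  · exact Or.inl hfar
  right
  obtain ⟨h1, h2, hr'⟩ := close_of_not_farAt hrlen hfar
  have hm := le_sub_of_add_le (h.upper r).2 (h.lower r).1 h1
  have hm' := le_sub_of_add_le (h.upper r).1 (h.lower r).2 h2
  suffices InnerPath l u l' u' δ r ∨ InnerPath l' u' l u δ r from
    this.imp (h.obstructedPath_of_innerPath hr hr' hm)
      (h.symm.obstructedPath_of_innerPath hr' hr hm')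
  -- If ends are `δ` apart somewhere between `r` and `t`, the first such diagonal ends a path from
  -- `r`. Otherwise the bars are close all the way back to `t`, and the given path can be appended.
  by_cases hE : ∃ s ∈ Set.uIcc r t, FarAt l u l' u' δ s
  · obtain ⟨c, hc, hcZ, hfirst⟩ := exists_first_hit h.isClosed_farAt hE
    have hsub : ∀ s ∈ Set.uIcc r c, s ∈ Set.uIcc t r := fun s hs => by
      rw [Set.uIcc_comm]; exact Set.uIcc_subset_uIcc_left hc hs
    have inner : ∀ s ∈ Set.uIcc r c, s ≠ c →
        l s + δ ≤ u' s ∧ l' s + δ ≤ u s ∧ l' s ≤ u' s := fun s hs hsc =>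
      close_of_not_farAt (hpath s (hsub s hs)).2 (hfirst s hs hsc)
    have hcT : l c ≤ u c := (hpath c (hsub c Set.right_mem_uIcc)).1
    have hcT' : l' c ≤ u' c := mem_of_forall_ne_mem h.dom'.1 hr' fun s hs hsc =>
      (inner s hs hsc).2.2
    refine hcZ.imp (fun hc => ⟨c, hcT, hcT', fun s hs => ?_, hc⟩)
      (fun hc => ⟨c, hcT', hcT, fun s hs => ?_, hc⟩)
    · by_cases hsc : s = c
      · subst hsc
        exact hc.elim (fun e => e.trans (EReal.sub_le_sub hcT' le_rfl))
          (fun e => e.trans (EReal.sub_le_sub le_rfl hcT))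
      · exact le_sub_of_add_le (h.upper s).2 (h.lower s).1 (inner s hs hsc).1
    · by_cases hsc : s = c
      · subst hsc
        exact hc.elim (fun e => e.trans (EReal.sub_le_sub hcT le_rfl))
          (fun e => e.trans (EReal.sub_le_sub le_rfl hcT'))
      · exact le_sub_of_add_le (h.upper s).1 (h.lower s).2 (inner s hs hsc).2.1
  · push Not at hE
    have close : ∀ s ∈ Set.uIcc r t, l s + δ ≤ u' s ∧ l' s + δ ≤ u s ∧ l' s ≤ u' s := fun s hs =>
      close_of_not_farAt (hpath s (by rwa [Set.uIcc_comm])).2 (hE s hs)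
    rcases hobs with hobs | ⟨c, hc, hend⟩ | ⟨c, hc, hend⟩
    · exact absurd hobs (hE t Set.right_mem_uIcc)
    · refine Or.inl (h.innerPath_of_path hr hr' ⟨c, fun s hs => ?_, hend⟩)
      rcases Set.uIcc_subset_uIcc_union_uIcc (b := t) hs with hs | hs
      · exact le_sub_of_add_le (h.upper s).2 (h.lower s).1 (close s hs).1
      · exact hc s hs
    · refine Or.inr (h.symm.innerPath_of_path hr' hr ⟨c, fun s hs => ?_, hend⟩)
      rcases Set.uIcc_subset_uIcc_union_uIcc (b := t) hs with hs | hs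
      · exact le_sub_of_add_le (h.upper s).1 (h.lower s).2 (close s hs).2.1
      · exact hc s hs

/-- Obstructions persist as long as no critical value is passed. -/
theorem IsGeneric.obstructed (h : IsGeneric l u l' u' δ δ') (hδ : 0 ≤ δ)
    (hobs : Obstructed l u l' u' δ) : Obstructed l u l' u' δ' := by
  obtain ⟨t, hlen | hlen, ht⟩ := hobs
  · exact h.obstructed_aux hδ hlen ht
  · exact (h.symm.obstructed_aux hδ hlen (ht.imp farAt_comm Or.symm)).symm

end

/-! ### Obstructions exclude interleavings -/

theorem translate_diagPt' (a t : ℝ) (σ : EReal) :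
    translate a (diagPt t σ) = diagPt t (σ + a) := by
  ext i
  fin_cases i
  · exact add_assoc _ _ _
  · rfl

theorem translate_translate {n : ℕ} (a b : ℝ) (x : Pt n) :
    translate a (translate b x) = translate (b + a) x := by
  ext i
  simp only [translate, add_assoc, EReal.coe_add]

theorem diagPt_le_diagPt {t : ℝ} {σ τ : EReal} (h : σ ≤ τ) : diagPt t σ ≤ diagPt t τ :=
  le_pt_iff.2 ⟨add_le_add le_rfl h, h⟩

theorem add_neg_coe_add_coe (x : EReal) (a : ℝ) : x + ((-a : ℝ) : EReal) + a = x := by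
  rw [add_assoc, ← EReal.coe_add, neg_add_cancel, EReal.coe_zero, add_zero]

theorem add_mul_sub_mem_uIcc {a b θ : ℝ} (h₀ : 0 ≤ θ) (h₁ : θ ≤ 1) :
    a + θ * (b - a) ∈ Set.uIcc a b := by
  rcases le_total a b with h | h
  · rw [Set.uIcc_of_le h]
    constructor <;> nlinarith
  · rw [Set.uIcc_of_ge h]
    constructor <;> nlinarith

theorem forall_mem_uIcc_of_step {P : ℝ → Prop} {a b η : ℝ} (hη : 0 < η) (ha : P a)
    (hstep : ∀ s ∈ Set.uIcc a b, ∀ s' ∈ Set.uIcc a b, |s' - s| ≤ η → P s → P s') : P b := by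
  obtain ⟨N, hN⟩ := exists_nat_gt (|b - a| / η)
  have hNpos : (0 : ℝ) < N := (div_nonneg (abs_nonneg _) hη.le).trans_lt hN
  have mem : ∀ k : ℕ, k ≤ N → a + k / N * (b - a) ∈ Set.uIcc a b := fun k hk =>
    add_mul_sub_mem_uIcc (by positivity) ((div_le_one hNpos).2 (Nat.cast_le.2 hk))
  have all : ∀ k : ℕ, k ≤ N → P (a + k / N * (b - a)) := by
    intro k
    induction k with
    | zero => intro _; simpa using ha
    | succ k ih =>
      intro hk
      refine hstep _ (mem k (by omega)) _ (mem _ hk) ?_ (ih (by omega))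
      have e : a + ((k + 1 : ℕ) : ℝ) / N * (b - a) - (a + k / N * (b - a)) = (b - a) / N := by
        push_cast
        ring
      rw [e, abs_div, abs_of_pos hNpos]
      rw [div_lt_iff₀ hη] at hN
      rw [div_le_iff₀ hNpos]
      linarith
  have := all N le_rfl
  rwa [div_self hNpos.ne', one_mul, add_sub_cancel] at this

section

variable {I J : Set (Pt 2)} {l u l' u' : ℝ → EReal} {δ : ℝ} {w : Pt 2 → Prop}

/-- Since the lower curve has slope between `-1` and `0`, passing between the lower ends on two
diagonals costs no more height than their distance. Their join is where naturality is applied in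
`IsSupport.propagate`. -/
theorem IsSlab.lower_sup_le (h : IsSlab I l u) {s s' η : ℝ} (hs : |s' - s| ≤ η) :
    diagPt s (l s) ⊔ diagPt s' (l s') ≤ diagPt s (l s + η) := by
  have hη : 0 ≤ η := (abs_nonneg _).trans hs
  obtain ⟨h1, h2⟩ := abs_le.1 hs
  refine sup_le (diagPt_le_diagPt (le_add_of_nonneg_right (EReal.coe_nonneg.2 hη))) ?_
  rw [le_pt_iff, diagPt_zero, diagPt_zero, diagPt_one, diagPt_one]
  rcases le_total s s' with hle | hle
  · have hl := h.stair_lower.anti hle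
    constructor
    · rw [add_comm (l s), ← add_assoc, ← EReal.coe_add]
      exact add_le_add (EReal.coe_le_coe_iff.2 (by linarith)) hl
    · exact hl.trans (le_add_of_nonneg_right (EReal.coe_nonneg.2 hη))
  · have hl := h.stair_lower.lip s' s hle
    constructor
    · refine (add_le_add le_rfl hl).trans ?_
      rw [add_comm (l s), add_comm (l s), ← add_assoc, ← add_assoc, ← EReal.coe_add,
        ← EReal.coe_add]
      exact add_le_add (EReal.coe_le_coe_iff.2 (by linarith)) le_rfl
    · exact hl.trans (add_le_add le_rfl (EReal.coe_le_coe_iff.2 (by linarith)))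

theorem IsSupport.upper_le (hw : IsSupport I J δ w) (h : IsSlab I l u) (h' : IsSlab J l' u') {s : ℝ}
    (hz : w (diagPt s (l s))) : l s ≤ u s ∧ l' s ≤ l s + δ ∧ l s + δ ≤ u' s ∧ u' s ≤ u s + δ := by
  obtain ⟨h1, h2⟩ := hw.mem _ hz
  have h3 := (h.mem_iff s _).1 h1
  rw [translate_diagPt', h'.mem_iff] at h2
  refine ⟨h3.2, h2.1, h2.2, ?_⟩
  -- The support extends up the diagonal as long as the shift remains in `J`, so up to height `u' s
  -- - δ`; that point must then lie in `I`.
  have hq : translate δ (diagPt s (u' s + ((-δ : ℝ) : EReal))) ∈ J := by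
    rw [translate_diagPt', add_neg_coe_add_coe, h'.mem_iff]
    exact ⟨h2.1.trans h2.2, le_rfl⟩
  have hle : diagPt s (l s) ≤ diagPt s (u' s + ((-δ : ℝ) : EReal)) :=
    diagPt_le_diagPt (add_coe_le_add_coe_iff.1 (by rw [add_neg_coe_add_coe]; exact h2.2))
  have := (hw.mem _ ((hw.iff _ _ hle h1 hq).1 hz)).1
  rw [h.mem_iff] at this
  rw [← add_neg_coe_add_coe (u' s) δ]
  exact add_le_add this.2 le_rfl

/-- The support of a morphism propagates along diagonals on which there is room for it. -/
theorem IsSupport.propagate (hw : IsSupport I J δ w) (h : IsSlab I l u) (h' : IsSlab J l' u')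
    {t₀ t : ℝ} (h₀ : w (diagPt t₀ (l t₀)))
    (hpath : ∀ s ∈ Set.uIcc t₀ t, (δ : EReal) < u' s - l s) : w (diagPt t (l t)) := by
  -- By compactness the room exceeds `δ` uniformly, and this surplus serves as the step length.
  obtain ⟨η, hη, hgap⟩ : ∃ η > 0, ∀ s ∈ Set.uIcc t₀ t, l s + δ + (η : ℝ) ≤ u' s := by
    obtain ⟨m, hm, hmin⟩ := isCompact_uIcc.exists_isMinOn Set.nonempty_uIcc
      ((h'.stair_upper.continuous_sub h.stair_lower).continuousOn (s := Set.uIcc t₀ t))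
    obtain ⟨c, hc1, hc2⟩ := EReal.lt_iff_exists_real_btwn.1 (hpath m hm)
    refine ⟨c - δ, sub_pos.2 (EReal.coe_lt_coe_iff.1 hc1), fun s hs => ?_⟩
    rw [add_assoc, ← EReal.coe_add, add_sub_cancel]
    exact add_le_of_le_sub (hc2.le.trans (hmin hs))
  refine forall_mem_uIcc_of_step (P := fun s => w (diagPt s (l s))) hη h₀ ?_
  intro s hs s' hs' hss' hws
  obtain ⟨h1, h2, h3, h4⟩ := hw.upper_le h h' hws
  have hsI := h.mem_of_le h1
  have hJ : diagPt s (l s + η + δ) ∈ J := by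
    rw [h'.mem_iff, add_right_comm]
    refine ⟨h2.trans (le_add_of_nonneg_right (EReal.coe_nonneg.2 hη.le)), hgap s hs⟩
  have hI : diagPt s (l s + η) ∈ I := by
    rw [h.mem_iff]
    refine ⟨le_add_of_nonneg_right (EReal.coe_nonneg.2 hη.le), ?_⟩
    rw [← add_coe_le_add_coe_iff (δ := δ), add_right_comm]
    exact (hgap s hs).trans h4
  have hle := h.lower_sup_le hss'
  have hp : diagPt s (l s) ⊔ diagPt s' (l s') ∈ I :=
    h.interval.convex _ hsI _ hI _ le_sup_left hle
  have hp' : translate δ (diagPt s (l s) ⊔ diagPt s' (l s')) ∈ J := by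
    refine h'.interval.convex _ (hw.mem _ hws).2 _ hJ _ (translate_mono δ le_sup_left) ?_
    rw [← translate_diagPt']
    exact translate_mono δ hle
  have hs'I : diagPt s' (l s') ∈ I :=
    h.mem_of_le ((h.le_upper _ _).2 ⟨_, hp, le_sup_right⟩)
  exact (hw.iff _ _ le_sup_right hs'I hp').2 ((hw.iff _ _ le_sup_left hsI hp').1 hws)

theorem IsSupport.not_obstructedPath (hw : IsSupport I J δ w) (h : IsSlab I l u)
    (h' : IsSlab J l' u') {t₀ δ' : ℝ} (hδ : δ < δ') (h₀ : w (diagPt t₀ (l t₀))) :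
    ¬ ObstructedPath l u l' u' δ' t₀ := by
  rintro ⟨t, hpath, hend⟩
  have hlt : (δ : EReal) < δ' := EReal.coe_lt_coe_iff.2 hδ
  obtain ⟨-, h2, -, h4⟩ := hw.upper_le h h'
    (hw.propagate h h' h₀ fun s hs => hlt.trans_le (hpath s hs))
  rcases hend with hend | hend
  · exact (add_lt_of_lt_sub (hlt.trans_le hend)).not_ge h2
  · exact (add_lt_of_lt_sub (hlt.trans_le hend)).not_ge h4

/-- The long bar makes both maps nonzero, at the lower end of each bar. The inequalities of
`IsSupport.upper_le`, applied in both directions, bring the ends within `δ` of each other, and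
propagation excludes the paths. Strictness of `δ < δ'` provides the strict room needed there. -/
theorem not_obstructed_aux (h : IsSlab I l u) (h' : IsSlab J l' u') {δ' : ℝ}
    (hδ₀ : 0 ≤ δ) (hδ : δ < δ') {w' : Pt 2 → Prop} (hw : IsSupport I J δ w)
    (hw' : IsSupport J I δ w')
    (hI : ∀ x ∈ I, translate δ (translate δ x) ∈ I → w x ∧ w' (translate δ x)) {t : ℝ}
    (hlen : ((2 * δ' : ℝ) : EReal) ≤ u t - l t) :
    ¬ (FarAt l u l' u' δ' t ∨ ObstructedPath l u l' u' δ' t ∨ ObstructedPath l' u' l u δ' t) := by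
  have hlt : (δ : EReal) < δ' := EReal.coe_lt_coe_iff.2 hδ
  have hlu := add_le_of_le_sub hlen
  rw [add_two_mul] at hlu
  have mono : ∀ x : EReal, x + (δ : EReal) ≤ x + (δ' : EReal) := fun x => add_le_add le_rfl hlt.le
  have nonneg : ∀ x : EReal, x ≤ x + (δ : EReal) := fun x =>
    le_add_of_nonneg_right (EReal.coe_nonneg.2 hδ₀)
  have hlu' : l t + δ + δ ≤ u t :=
    ((add_le_add (mono _) le_rfl).trans (mono _)).trans hlu
  have ht : l t ≤ u t := ((nonneg _).trans (nonneg _)).trans hlu'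
  obtain ⟨hw1, hw2⟩ := hI _ (h.mem_of_le ht) (by
    rw [translate_diagPt', translate_diagPt', h.mem_iff]
    exact ⟨(nonneg _).trans (nonneg _), hlu'⟩)
  obtain ⟨-, h2, h3, h4⟩ := hw.upper_le h h' hw1
  have hw3 : w' (diagPt t (l' t)) := by
    rw [translate_diagPt'] at hw2
    refine (hw'.iff _ _ (diagPt_le_diagPt h2) (h'.mem_of_le (h2.trans h3)) ?_).2 hw2
    rw [translate_diagPt', h.mem_iff]
    exact ⟨(nonneg _).trans (nonneg _), hlu'⟩
  obtain ⟨-, h5, -, h6⟩ := hw'.upper_le h' h hw3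
  rintro (((e | e) | (e | e)) | e | e)
  · exact (add_lt_of_lt_sub (hlt.trans_le e)).not_ge h2
  · exact (add_lt_of_lt_sub (hlt.trans_le e)).not_ge h4
  · exact (add_lt_of_lt_sub (hlt.trans_le e)).not_ge h5
  · exact (add_lt_of_lt_sub (hlt.trans_le e)).not_ge h6
  · exact hw.not_obstructedPath h h' hδ hw1 e
  · exact hw'.not_obstructedPath h' h hδ hw3 e

theorem Interleaved.not_obstructed {K : Type u} [Field K] {δ : ℝ≥0} {hI : IsInterval I}
    {hJ : IsInterval J} (hint : Interleaved (intervalModule K I hI) (intervalModule K J hJ) δ)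
    (h : IsSlab I l u) (h' : IsSlab J l' u') {δ' : ℝ} (hδ : δ < δ') :
    ¬ Obstructed l u l' u' δ' := by
  obtain ⟨w, w', hw, hw', h1, h2⟩ := hint.exists_isSupport
  rintro ⟨t, ht | ht, hobs⟩
  · exact not_obstructed_aux h h' δ.2 hδ hw hw' h1 ht hobs
  · exact not_obstructed_aux h' h δ.2 hδ hw' hw h2 ht (hobs.imp farAt_comm Or.symm)

end

/-! ### Interleavings exist without obstructions -/

/-- Membership in `I` does not depend on the exact values of coordinates beyond `C`. -/
def IsTame (I : Set (Pt 2)) (C : ℝ) : Prop :=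
  ∀ x y : Pt 2, (∀ i, x i = y i ∨ ((C : EReal) < x i ∧ (C : EReal) < y i) ∨
    (x i < ((-C : ℝ) : EReal) ∧ y i < ((-C : ℝ) : EReal))) → x ∈ I → y ∈ I

/-- An extended real, moved into `[-c, c]`. -/
def clamp (c : ℝ) (x : EReal) : ℝ := (max ((-c : ℝ) : EReal) (min x c)).toReal

theorem coe_clamp (c : ℝ) (x : EReal) :
    (clamp c x : EReal) = max ((-c : ℝ) : EReal) (min x c) := by
  refine EReal.coe_toReal (ne_of_lt ?_) (ne_of_gt ?_)
  · exact max_lt (EReal.coe_lt_top _) ((min_le_right _ _).trans_lt (EReal.coe_lt_top _))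
  · exact (EReal.bot_lt_coe _).trans_le (le_max_left _ _)

theorem clamp_mono {c : ℝ} {x y : EReal} (h : x ≤ y) : clamp c x ≤ clamp c y := by
  rw [← EReal.coe_le_coe_iff, coe_clamp, coe_clamp]
  exact max_le_max le_rfl (min_le_min h le_rfl)

/-- The translate of a point, and the translate of the nearest point of `[-c, c]²`. -/
theorem clamp_cases {c C a : ℝ} (hc : 0 ≤ c) (ha : C + |a| < c) (x : EReal) :
    x + a = clamp c x + a ∨ ((C : EReal) < x + a ∧ (C : EReal) < clamp c x + a) ∨
      (x + a < ((-C : ℝ) : EReal) ∧ clamp c x + a < ((-C : ℝ) : EReal)) := by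
  rw [coe_clamp]
  have h1 := neg_abs_le a
  have h2 := le_abs_self a
  rcases lt_or_ge x ((-c : ℝ) : EReal) with hx | hx
  · right; right
    rw [max_eq_left ((min_le_left _ _).trans hx.le)]
    have : ((-c : ℝ) : EReal) + a < ((-C : ℝ) : EReal) := by
      rw [← EReal.coe_add, EReal.coe_lt_coe_iff]; linarith
    exact ⟨(add_le_add hx.le le_rfl).trans_lt this, this⟩
  rcases lt_or_ge (c : EReal) x with hx' | hx'
  · right; left
    rw [min_eq_right hx'.le, max_eq_right (EReal.coe_le_coe_iff.2 (by linarith))]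
    have : (C : EReal) < (c : EReal) + a := by
      rw [← EReal.coe_add, EReal.coe_lt_coe_iff]; linarith
    exact ⟨this.trans_le (add_le_add hx'.le le_rfl), this⟩
  · left
    rw [min_eq_left hx', max_eq_right hx]

/-- The diagonal of the point of `[-c, c]²` nearest to `x`. -/
def clampDiag (c : ℝ) (x : Pt 2) : ℝ := clamp c (x 0) - clamp c (x 1)

/-- The point of `[-c, c]²` nearest to `x`. -/
def clampPt (c : ℝ) (x : Pt 2) : Pt 2 := diagPt (clampDiag c x) (clamp c (x 1))

theorem clampPt_zero (c : ℝ) (x : Pt 2) : clampPt c x 0 = clamp c (x 0) := by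
  rw [clampPt, coe_diagPt_zero, clampDiag, sub_add_cancel]

theorem clampPt_one (c : ℝ) (x : Pt 2) : clampPt c x 1 = clamp c (x 1) := rfl

theorem IsTame.translate_clampPt_mem {I : Set (Pt 2)} {C c a : ℝ} (h : IsTame I C) (hc : 0 ≤ c)
    (ha : C + |a| < c) (x : Pt 2) : translate a (clampPt c x) ∈ I ↔ translate a x ∈ I := by
  have key : ∀ i, translate a x i = translate a (clampPt c x) i ∨
      ((C : EReal) < translate a x i ∧ (C : EReal) < translate a (clampPt c x) i) ∨
      (translate a x i < ((-C : ℝ) : EReal) ∧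
        translate a (clampPt c x) i < ((-C : ℝ) : EReal)) := by
    rw [Fin.forall_fin_two]
    unfold translate
    rw [clampPt_zero, clampPt_one]
    exact ⟨clamp_cases hc ha _, clamp_cases hc ha _⟩
  exact ⟨h _ _ fun i => (key i).imp Eq.symm (Or.imp And.symm And.symm), h _ _ key⟩

theorem translate_zero {n : ℕ} (x : Pt n) : translate 0 x = x := by
  ext i
  simp [translate]

section

variable {I J : Set (Pt 2)} {l u l' u' : ℝ → EReal} {δ c : ℝ}

/-- Each diagonal between those of `x` and `y` has a point between `x` and `y`, namely its lowest
point above `x`, whose height is `σ` in the proof. So the path of diagonals has room `δ`. -/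
theorem le_sub_between (h : IsSlab I l u) (h' : IsSlab J l' u') {x y : Pt 2}
    (hxy : x ≤ y) (hx : clampPt c x ∈ I) (hy : translate δ (clampPt c y) ∈ J) :
    ∀ s ∈ Set.uIcc (clampDiag c x) (clampDiag c y), (δ : EReal) ≤ u' s - l s := by
  intro s hs
  have h0 := clamp_mono (c := c) (hxy 0)
  have h1 := clamp_mono (c := c) (hxy 1)
  set σ : ℝ := max (clamp c (x 1)) (clamp c (x 0) - s) with hσ
  obtain ⟨hs1, hs2⟩ : (clampDiag c x ≤ s ∨ clampDiag c y ≤ s) ∧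
      (s ≤ clampDiag c x ∨ s ≤ clampDiag c y) := by
    rcases le_total (clampDiag c x) (clampDiag c y) with hle | hle
    · rw [Set.uIcc_of_le hle] at hs
      exact ⟨Or.inl hs.1, Or.inr hs.2⟩
    · rw [Set.uIcc_of_ge hle] at hs
      exact ⟨Or.inr hs.1, Or.inl hs.2⟩
  have e1 : l s ≤ σ := by
    refine (h.lower_le s σ).2 ⟨_, hx, le_pt_iff.2 ⟨?_, ?_⟩⟩
    · rw [clampPt_zero, coe_diagPt_zero, EReal.coe_le_coe_iff]
      linarith [le_max_right (clamp c (x 1)) (clamp c (x 0) - s)]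
    · rw [clampPt_one, diagPt_one, EReal.coe_le_coe_iff]
      exact le_max_left _ _
  have e2 : (σ : EReal) + δ ≤ u' s := by
    refine (h'.le_upper s _).2 ⟨_, hy, ?_⟩
    rw [← translate_diagPt']
    refine translate_mono δ (le_pt_iff.2 ⟨?_, ?_⟩)
    · rw [clampPt_zero, coe_diagPt_zero, EReal.coe_le_coe_iff, ← le_sub_iff_add_le']
      refine max_le ?_ (by linarith)
      rcases hs2 with hs2 | hs2 <;> unfold clampDiag at hs2 <;> linarith
    · rw [clampPt_one, diagPt_one, EReal.coe_le_coe_iff]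
      refine max_le h1 ?_
      rcases hs1 with hs1 | hs1 <;> unfold clampDiag at hs1 <;> linarith
  exact le_sub_of_add_le (h'.upper_ne_bot s) (h.lower_ne_top s) ((add_le_add e1 le_rfl).trans e2)

/-- The path does not end in an obstruction, so `l' t ≤ l t + δ` and `u' t ≤ u t + δ`; these bounds
supply the two missing inequalities. -/
theorem mem_of_not_obstructedPath (h : IsSlab I l u) (h' : IsSlab J l' u') {t₀ t : ℝ} {σ : EReal}
    (hobs : ¬ ObstructedPath l u l' u' δ t₀)
    (hpath : ∀ s ∈ Set.uIcc t₀ t, (δ : EReal) ≤ u' s - l s) (h₁ : l t ≤ σ) (h₂ : σ + δ ≤ u' t) :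
    diagPt t σ ∈ I ∧ translate δ (diagPt t σ) ∈ J := by
  have h0 : ¬ ((δ : EReal) ≤ l' t - l t ∨ (δ : EReal) ≤ u' t - u t) := fun e =>
    hobs ⟨t, hpath, e⟩
  rw [not_or] at h0
  have h3 := le_add_of_not_le_sub h0.1
  have h4 := le_add_of_not_le_sub h0.2
  rw [translate_diagPt', h.mem_iff, h'.mem_iff]
  exact ⟨⟨h₁, add_coe_le_add_coe_iff.1 (h₂.trans h4)⟩, h3.trans (add_le_add h₁ le_rfl), h₂⟩

/-- Induction on `Reach`: the diagonal of a reached point is joined, with room `δ`, to one with a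
long bar. A point outside the allowed region would turn this path into an obstruction. Clamping to a
box replaces points at or near infinity by points on real diagonals. -/
theorem reach_invariant {C : ℝ} (h : IsSlab I l u) (h' : IsSlab J l' u') (hIC : IsTame I C)
    (hJC : IsTame J C) (hc : 0 ≤ c) (hδ : 0 ≤ δ) (hcC : C + 2 * δ < c)
    (hobs : ¬ Obstructed l u l' u' δ) (x : Pt 2) (hx : Reach I J δ x) :
    (x ∈ I ∧ translate δ x ∈ J) ∧
    ∃ t₀, (((2 * δ : ℝ) : EReal) ≤ u t₀ - l t₀ ∨ ((2 * δ : ℝ) : EReal) ≤ u' t₀ - l' t₀) ∧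
      ∀ s ∈ Set.uIcc t₀ (clampDiag c x), (δ : EReal) ≤ u' s - l s := by
  have tI : ∀ a : ℝ, |a| ≤ 2 * δ → ∀ x, translate a (clampPt c x) ∈ I ↔ translate a x ∈ I :=
    fun a ha => hIC.translate_clampPt_mem hc (by linarith)
  have tJ : ∀ a : ℝ, |a| ≤ 2 * δ → ∀ x, translate a (clampPt c x) ∈ J ↔ translate a x ∈ J :=
    fun a ha => hJC.translate_clampPt_mem hc (by linarith)
  have tI0 : ∀ x, clampPt c x ∈ I ↔ x ∈ I := fun x => by
    have := tI 0 (by simpa using hδ) x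
    rwa [translate_zero, translate_zero] at this
  have tJ1 := tJ δ (by rw [abs_of_nonneg hδ]; linarith)
  have finish : ∀ x t₀, (((2 * δ : ℝ) : EReal) ≤ u t₀ - l t₀ ∨
      ((2 * δ : ℝ) : EReal) ≤ u' t₀ - l' t₀) →
      (∀ s ∈ Set.uIcc t₀ (clampDiag c x), (δ : EReal) ≤ u' s - l s) →
      l (clampDiag c x) ≤ clamp c (x 1) → clamp c (x 1) + (δ : EReal) ≤ u' (clampDiag c x) →
      x ∈ I ∧ translate δ x ∈ J := by
    intro x t₀ ht₀ hpath h1 h2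
    rw [← tI0, ← tJ1]
    exact mem_of_not_obstructedPath h h' (fun e => hobs ⟨t₀, ht₀, Or.inr (Or.inl e)⟩) hpath h1 h2
  have step : ∀ a x y b : Pt 2, a ∈ I → translate δ b ∈ J → a ≤ y → y ≤ b → (∃ t₀,
      (((2 * δ : ℝ) : EReal) ≤ u t₀ - l t₀ ∨ ((2 * δ : ℝ) : EReal) ≤ u' t₀ - l' t₀) ∧
      ∀ s ∈ Set.uIcc t₀ (clampDiag c x), (δ : EReal) ≤ u' s - l s) →
      (∀ s ∈ Set.uIcc (clampDiag c x) (clampDiag c y), (δ : EReal) ≤ u' s - l s) →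
      (y ∈ I ∧ translate δ y ∈ J) ∧ ∃ t₀,
      (((2 * δ : ℝ) : EReal) ≤ u t₀ - l t₀ ∨ ((2 * δ : ℝ) : EReal) ≤ u' t₀ - l' t₀) ∧
      ∀ s ∈ Set.uIcc t₀ (clampDiag c y), (δ : EReal) ≤ u' s - l s := by
    rintro a x y b ha hb hay hyb ⟨t₀, ht₀, hp⟩ hp'
    have hp'' : ∀ s ∈ Set.uIcc t₀ (clampDiag c y), (δ : EReal) ≤ u' s - l s := fun s hs =>
      (Set.uIcc_subset_uIcc_union_uIcc (b := clampDiag c x) hs).elim (hp s) (hp' s)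
    have mono : ∀ {x y : Pt 2}, x ≤ y → clampPt c x ≤ clampPt c y := fun {x y} hxy => by
      rw [le_pt_iff, clampPt_zero, clampPt_zero, clampPt_one, clampPt_one,
        EReal.coe_le_coe_iff, EReal.coe_le_coe_iff]
      exact ⟨clamp_mono (hxy 0), clamp_mono (hxy 1)⟩
    refine ⟨finish y t₀ ht₀ hp'' ?_ ?_, t₀, ht₀, hp''⟩
    · exact (h.lower_le _ _).2 ⟨_, (tI0 a).2 ha, mono hay⟩
    · refine (h'.le_upper _ _).2 ⟨_, (tJ1 b).2 hb, ?_⟩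
      rw [← translate_diagPt']
      exact translate_mono δ (mono hyb)
  have notFar : ∀ t₀, (((2 * δ : ℝ) : EReal) ≤ u t₀ - l t₀ ∨
      ((2 * δ : ℝ) : EReal) ≤ u' t₀ - l' t₀) → ¬ FarAt l u l' u' δ t₀ := fun t₀ ht₀ e =>
    hobs ⟨t₀, ht₀, Or.inl e⟩
  induction hx with
  | source x hx hx' =>
    rw [translate_translate, ← two_mul, ← tI _ (by rw [abs_of_nonneg (by linarith)])] at hx'
    rw [← tI0] at hx
    have h1 := ((h.mem_iff _ _).1 hx).1
    have h2 : (clamp c (x 1) : EReal) + ((2 * δ : ℝ) : EReal) ≤ u (clampDiag c x) := by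
      rw [clampPt, translate_diagPt', h.mem_iff] at hx'
      exact hx'.2
    have hlen := le_sub_of_add_le (h.upper_ne_bot _) (h.lower_ne_top _)
      ((add_le_add h1 le_rfl).trans h2)
    have hfar := notFar _ (Or.inl hlen)
    have hp : ∀ s ∈ Set.uIcc (clampDiag c x) (clampDiag c x), (δ : EReal) ≤ u' s - l s := by
      intro s hs
      rw [Set.uIcc_self, Set.mem_singleton_iff] at hs
      rw [hs]
      exact le_sub_of_add_le (h'.upper_ne_bot _) (h.lower_ne_top _)
        (close_of_not_farAt hlen hfar).1
    refine ⟨finish x _ (Or.inl hlen) hp h1 ?_, _, Or.inl hlen, hp⟩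
    simp only [FarAt, not_or] at hfar
    have h3 := le_add_of_not_le_sub hfar.2.2
    rw [add_two_mul] at h2
    exact add_coe_le_add_coe_iff.1 (h2.trans h3)
  | target y hy hy' =>
    set x := translate δ y with hx
    have hyx : translate (-δ) x ∈ J := by
      rwa [hx, translate_translate, add_neg_cancel, translate_zero]
    rw [← tJ _ (by rw [abs_neg, abs_of_nonneg hδ]; linarith)] at hyx
    rw [← tJ1, clampPt, translate_diagPt', h'.mem_iff] at hy'
    rw [clampPt, translate_diagPt', h'.mem_iff] at hyx
    have h0 : l' (clampDiag c x) + δ ≤ clamp c (x 1) := by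
      have := add_le_add_left hyx.1 (δ : EReal)
      rwa [add_neg_coe_add_coe] at this
    have hlen : ((2 * δ : ℝ) : EReal) ≤ u' (clampDiag c x) - l' (clampDiag c x) := by
      refine le_sub_of_add_le (h'.upper_ne_bot _) (h'.lower_ne_top _) ?_
      rw [add_two_mul]
      exact (add_le_add h0 le_rfl).trans hy'.2
    have hfar := notFar _ (Or.inr hlen)
    simp only [FarAt, not_or] at hfar
    have h1 : l (clampDiag c x) ≤ clamp c (x 1) := (le_add_of_not_le_sub hfar.2.1).trans h0
    have hp : ∀ s ∈ Set.uIcc (clampDiag c x) (clampDiag c x), (δ : EReal) ≤ u' s - l s := by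
      intro s hs
      rw [Set.uIcc_self, Set.mem_singleton_iff] at hs
      rw [hs]
      exact le_sub_of_add_le (h'.upper_ne_bot _) (h.lower_ne_top _)
        ((add_le_add h1 le_rfl).trans hy'.2)
    exact ⟨finish x _ (Or.inr hlen) hp h1 hy'.2, _, Or.inr hlen, hp⟩
  | up x y hxy hr hx hy ih =>
    exact step x x y y hx hy hxy le_rfl ih.2
      (le_sub_between h h' hxy ((tI0 x).2 hx) ((tJ1 y).2 hy))
  | down x y hxy hr hy hx ih =>
    refine step y x y x hy hx le_rfl hxy ih.2 ?_
    rw [Set.uIcc_comm]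
    exact le_sub_between h h' hxy ((tI0 y).2 hy) ((tJ1 x).2 hx)

theorem interleaved_of_not_obstructed (K : Type u) [Field K] {C : ℝ} {δ : ℝ≥0} (h : IsSlab I l u)
    (h' : IsSlab J l' u') (hIC : IsTame I C) (hJC : IsTame J C)
    (hobs : ¬ Obstructed l u l' u' δ) :
    Interleaved (intervalModule K I h.interval) (intervalModule K J h'.interval) δ := by
  -- Points are shifted by at most `2 * δ`, so this box is large enough for clamping to respect
  -- membership; the absolute value keeps its size nonnegative.
  have hc : (0 : ℝ) ≤ |C| + 2 * δ + 1 := by positivity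
  have hcC : C + 2 * δ < |C| + 2 * δ + 1 := by linarith [le_abs_self C]
  exact interleaved_of_reach K _ _ δ
    (fun x hx => (reach_invariant h h' hIC hJC hc δ.2 hcC hobs x hx).1)
    (fun x hx => (reach_invariant h' h hJC hIC hc δ.2 hcC (fun e => hobs e.symm) x hx).1)

end

/-! ### Vertices -/

theorem isTame_mono {I : Set (Pt 2)} {C C' : ℝ} (h : IsTame I C) (hC : C ≤ C') : IsTame I C' :=
  fun x y hxy => h x y fun i => (hxy i).imp id (Or.imp
    (And.imp (EReal.coe_le_coe_iff.2 hC).trans_lt (EReal.coe_le_coe_iff.2 hC).trans_lt)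
    (And.imp (fun e => e.trans_le (EReal.coe_le_coe_iff.2 (neg_le_neg hC)))
      (fun e => e.trans_le (EReal.coe_le_coe_iff.2 (neg_le_neg hC)))))

theorem eq_bot_or_top_or_abs_le (x : EReal) {C : ℝ} (h : |x.toReal| ≤ C) :
    x = ⊥ ∨ x = ⊤ ∨ ((-C : ℝ) : EReal) ≤ x ∧ x ≤ C := by
  induction x with
  | bot => exact Or.inl rfl
  | top => exact Or.inr (Or.inl rfl)
  | coe x =>
    rw [EReal.toReal_coe, abs_le] at h
    exact Or.inr (Or.inr ⟨EReal.coe_le_coe_iff.2 h.1, EReal.coe_le_coe_iff.2 h.2⟩)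

theorem exists_isTame {I : Set (Pt 2)} (R : Finset (Pt 2 × Pt 2))
    (hR : ∀ r ∈ R, ∀ i, r.1 i < r.2 i) (hIR : I = ⋃ r ∈ R, Set.Icc r.1 r.2) :
    ∃ C, 0 ≤ C ∧ IsTame I C := by
  have hC : ∀ r ∈ R, ∀ i, |(r.1 i).toReal| + |(r.2 i).toReal| ≤
      ∑ r ∈ R, ∑ i, (|(r.1 i).toReal| + |(r.2 i).toReal|) := fun r hr i =>
    (Finset.single_le_sum (f := fun i => |(r.1 i).toReal| + |(r.2 i).toReal|)
      (fun i _ => by positivity) (Finset.mem_univ i)).trans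
    (Finset.single_le_sum (f := fun r : Pt 2 × Pt 2 => ∑ i, (|(r.1 i).toReal| + |(r.2 i).toReal|))
      (fun r _ => by positivity) hr)
  -- Infinite coordinates contribute `0` here, and every real coordinate of a corner lies in `[-C,
  -- C]`.
  set C := ∑ r ∈ R, ∑ i, (|(r.1 i).toReal| + |(r.2 i).toReal|) with hCdef
  refine ⟨C, by positivity, fun x y hxy hx => ?_⟩
  rw [hIR] at hx ⊢
  simp only [Set.mem_iUnion, exists_prop] at hx ⊢
  obtain ⟨r, hr, h1, h2⟩ := hx
  refine ⟨r, hr, fun i => ?_, fun i => ?_⟩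
  · rcases hxy i with e | ⟨e, e'⟩ | ⟨e, e'⟩
    · exact e ▸ h1 i
    · rcases eq_bot_or_top_or_abs_le (r.1 i) ((le_add_of_nonneg_right (abs_nonneg _)).trans
        (hC r hr i)) with h | h | h
      · exact h ▸ bot_le
      · exact absurd h (lt_top_of_lt (hR r hr i)).ne
      · exact h.2.trans e'.le
    · rcases eq_bot_or_top_or_abs_le (r.1 i) ((le_add_of_nonneg_right (abs_nonneg _)).trans
        (hC r hr i)) with h | h | h
      · exact h ▸ bot_le
      · exact absurd h (lt_top_of_lt (hR r hr i)).ne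
      · exact absurd (h.1.trans (h1 i)) e.not_ge
  · rcases hxy i with e | ⟨e, e'⟩ | ⟨e, e'⟩
    · exact e ▸ h2 i
    · rcases eq_bot_or_top_or_abs_le (r.2 i) ((le_add_of_nonneg_left (abs_nonneg _)).trans
        (hC r hr i)) with h | h | h
      · exact absurd h (bot_lt_of_lt (hR r hr i)).ne'
      · exact h ▸ le_top
      · exact absurd ((h2 i).trans h.2) e.not_ge
    · rcases eq_bot_or_top_or_abs_le (r.2 i) ((le_add_of_nonneg_left (abs_nonneg _)).trans
        (hC r hr i)) with h | h | h
      · exact absurd h (bot_lt_of_lt (hR r hr i)).ne'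
      · exact h ▸ le_top
      · exact e'.le.trans h.1

/-- Choose a point of the edge whose other coordinate `s` avoids all rectangle sides. Unless `c` is
a side coordinate, this point is strictly inside a rectangle of `I` and cannot be on a boundary. -/
theorem coord_mem_of_edge {I F : Set (Pt 2)} {T : Set ℝ} {p : ℝ → EReal} (R : Finset (Pt 2 × Pt 2))
    (hIR : I = ⋃ r ∈ R, Set.Icc r.1 r.2) (h : IsCurve I F T p) (hFI : F ⊆ I)
    {i j : Fin 2} (hij : ∀ k, k = i ∨ k = j) (hne : j ≠ i) {c : EReal} {x y : Pt 2} (hx : x ∈ F)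
    (hy : y ∈ F) (hxc : x i = c) (hyc : y i = c) (hlt : x j < y j) :
    ∃ r ∈ R, c = r.1 i ∨ c = r.2 i := by
  have hfin : ((fun r : Pt 2 × Pt 2 => r.1 j) '' R ∪ (fun r : Pt 2 × Pt 2 => r.2 j) '' R).Finite :=
    (R.finite_toSet.image _).union (R.finite_toSet.image _)
  obtain ⟨s, ⟨hs1, hs2⟩, hs⟩ := (Set.Ioo_infinite hlt).exists_notMem_finite hfin
  have hz : Function.update (fun _ => s) i c ∈ F := by
    refine h.convex x hx y hy _ (fun k => ?_) (fun k => ?_) <;> rcases hij k with rfl | rfl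
    · simp [hxc]
    · simpa [hne] using hs1.le
    · simp [hyc]
    · simpa [hne] using hs2.le
  have hzI := hFI hz
  have hz' := hz
  rw [hIR] at hzI
  simp only [Set.mem_iUnion, exists_prop] at hzI
  obtain ⟨r, hr, h1, h2⟩ := hzI
  refine ⟨r, hr, ?_⟩
  by_contra hcon
  push Not at hcon
  have e1 := h1 i
  have e2 := h2 i
  have e3 := h1 j
  have e4 := h2 j
  simp only [Function.update_self, Function.update_of_ne hne] at e1 e2 e3 e4
  have sub : Set.Icc r.1 r.2 ⊆ I := fun w hw => by
    rw [hIR]; simp only [Set.mem_iUnion, exists_prop]; exact ⟨r, hr, hw⟩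
  have hs3 : r.1 j ≠ s := fun e => hs (Or.inl ⟨r, hr, e⟩)
  have hs4 : r.2 j ≠ s := fun e => hs (Or.inr ⟨r, hr, e⟩)
  have lo : ∀ k, r.1 k < Function.update (fun _ => s) i c k := fun k => by
    rcases hij k with rfl | rfl
    · simpa using lt_of_le_of_ne e1 hcon.1.symm
    · simpa [hne] using lt_of_le_of_ne e3 hs3
  have hi : ∀ k, Function.update (fun _ => s) i c k < r.2 k := fun k => by
    rcases hij k with rfl | rfl
    · simpa using lt_of_le_of_ne e2 hcon.2
    · simpa [hne] using lt_of_le_of_ne e4 hs4.symm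
  have hle : r.1 ≤ r.2 := h1.trans h2
  rcases h.side with e | e
  · rw [e] at hz
    exact hz.2 r.1 lo (sub ⟨le_rfl, hle⟩)
  · rw [e] at hz
    exact hz.2 r.2 hi (sub ⟨hle, le_rfl⟩)

theorem finite_vertices {I : Set (Pt 2)} {l u : ℝ → EReal} (h : IsSlab I l u)
    (R : Finset (Pt 2 × Pt 2)) (hIR : I = ⋃ r ∈ R, Set.Icc r.1 r.2) : (vertices I).Finite := by
  let G : Set EReal := ⋃ r ∈ R, (Set.range r.1 ∪ Set.range r.2)
  have hG : G.Finite := R.finite_toSet.biUnion fun r _ =>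
    (Set.finite_range _).union (Set.finite_range _)
  have hedge : (edges I).Finite := by
    refine ((({lowerBoundary I, upperBoundary I} : Set (Set (Pt 2))).toFinite.prod
      ((Set.finite_univ (α := Fin 2)).prod hG)).image
      fun q => {x | x ∈ q.1 ∧ x q.2.1 = q.2.2}).subset ?_
    rintro e ⟨⟨x, hx, y, hy, hxy⟩, F, hF, i, c, rfl⟩
    refine ⟨(F, i, c), ⟨hF, Set.mem_univ _, ?_⟩, rfl⟩
    obtain ⟨T, p, hc⟩ : ∃ T p, IsCurve I F T p := by
      rcases hF with rfl | rfl
      · exact ⟨_, _, h.isCurve_lower⟩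
      · exact ⟨_, _, h.isCurve_upper⟩
    have hFI : F ⊆ I := by
      rcases hF with rfl | rfl <;> exact fun z hz => h.closed.closure_eq ▸ hz.1
    obtain ⟨j, hij, hne⟩ := (by decide : ∀ i : Fin 2, ∃ j : Fin 2, (∀ k, k = i ∨ k = j) ∧ j ≠ i) i
    have hj : x j ≠ y j := fun e => hxy (funext fun k => by
      rcases hij k with rfl | rfl
      · exact hx.2.trans hy.2.symm
      · exact e)
    have : ∃ r ∈ R, c = r.1 i ∨ c = r.2 i := by
      rcases lt_or_gt_of_ne hj with hlt | hlt
      · exact coord_mem_of_edge R hIR hc hFI hij hne hx.1 hy.1 hx.2 hy.2 hlt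
      · exact coord_mem_of_edge R hIR hc hFI hij hne hy.1 hx.1 hy.2 hx.2 hlt
    obtain ⟨r, hr, e⟩ := this
    simp only [G, Set.mem_iUnion, exists_prop]
    exact ⟨r, hr, e.imp (fun e => ⟨i, e.symm⟩) (fun e => ⟨i, e.symm⟩)⟩
  have : vertices I = ⋃ e ∈ edges I, ({v | IsLeast e v} ∪ {v | IsGreatest e v}) := by
    ext v
    simp [vertices]
  rw [this]
  exact hedge.biUnion fun e _ =>
    (Set.Subsingleton.finite fun x hx y hy => IsLeast.unique hx hy).union
      (Set.Subsingleton.finite fun x hx y hy => IsGreatest.unique hx hy)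

namespace IsSlab

variable {I : Set (Pt 2)} {l u : ℝ → EReal}

/-- The first vertex of the bottom edge (or of the left edge). -/
theorem exists_vertex_of_min (h : IsSlab I l u) {i j : Fin 2} (hij : ∀ k, k = i ∨ k = j)
    (hne : j ≠ i) {a b : Pt 2} (hab : ∀ k, a k < b k) (hsub : Set.Icc a b ⊆ I)
    (hmin : ∀ x ∈ I, a j ≤ x j) :
    ∃ v ∈ vertices I, v ∈ lowerBoundary I ∧ v j = a j ∧ v i ≤ a i := by
  have hle : a ≤ b := fun k => (hab k).le
  have hL : ∀ x ∈ I, x j = a j → x ∈ lowerBoundary I := fun x hx hxa =>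
    ⟨subset_closure hx, fun y hy hyI => ((hy j).trans_eq hxa).not_ge (hmin y hyI)⟩
  have ha : a ∈ lowerBoundary I ∧ a j = a j := ⟨hL a (hsub ⟨le_rfl, hle⟩) rfl, rfl⟩
  obtain ⟨v, hv⟩ := h.isCurve_lower.exists_isLeast (i := j) (j := i) (fun k => (hij k).symm) ha
  have hva := hv.2 ha i
  have hw : Function.update b j (a j) ∈ lowerBoundary I ∧ Function.update b j (a j) j = a j := by
    refine ⟨hL _ (hsub ⟨fun k => ?_, fun k => ?_⟩) (by simp), by simp⟩ <;>
      rcases hij k with rfl | rfl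
    · simpa [hne.symm] using hle _
    · simp
    · simp [hne.symm]
    · simpa using hle _
  refine ⟨v, h.isCurve_lower.vertex_of_isLeast hv hw fun e => ?_, hv.1.1, hv.1.2, hva⟩
  have := congrFun e i
  rw [Function.update_of_ne hne.symm] at this
  exact (hva.trans_lt (hab i)).ne this.symm

/-- Compactness of the parameter square gives a lowest point of `I`, and hence a bottom edge,
possibly at infinity. -/
theorem exists_vertex_mem_lowerBoundary (h : IsSlab I l u) :
    ∃ v ∈ vertices I, v ∈ lowerBoundary I := by
  obtain ⟨z, hz, hmin⟩ := h.closed.isCompact.exists_isMinOn h.interval.nonempty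
    (continuous_apply (1 : Fin 2)).continuousOn
  obtain ⟨a, b, hab, haz, hzb, hsub⟩ := h.fat z hz
  obtain ⟨v, hv, hvL, -⟩ := h.exists_vertex_of_min (i := 0) (j := 1) (by decide) (by decide) hab hsub
    fun x hx => (haz 1).trans (hmin hx)
  exact ⟨v, hv, hvL⟩

/-- Every real translate of the vertex stays strictly below the corner `b`, so its diagonal never
meets the upper boundary. -/
theorem dl_eq_top_of_bot (h : IsSlab I l u) {i j : Fin 2} (hij : ∀ k, k = i ∨ k = j)
    (hne : j ≠ i) {a b : Pt 2} (hab : ∀ k, a k < b k) (hsub : Set.Icc a b ⊆ I) (hj : a j = ⊥)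
    (hi : a i = ⊥ ∨ b i = ⊤) : ∃ v ∈ vertices I, dl v (upperBoundary I) = ⊤ := by
  obtain ⟨v, hv, -, hvj, hvi⟩ := h.exists_vertex_of_min hij hne hab hsub fun x _ => hj ▸ bot_le
  refine ⟨v, hv, iInf₂_eq_top.2 ?_⟩
  rintro y ⟨⟨t, rfl⟩, hy⟩
  refine absurd (hsub ⟨fun k => (hab k).le, le_rfl⟩) (hy.2 b fun k => ?_)
  rcases hij k with rfl | rfl
  · change v k + (t : EReal) < b k
    rcases hi with hi | hi
    · rw [hi, le_bot_iff] at hvi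
      rw [hvi, EReal.bot_add]
      exact bot_lt_of_lt (hab k)
    · rw [hi]
      exact EReal.add_lt_top (hvi.trans_lt (lt_top_of_lt (hab k))).ne (EReal.coe_ne_top _)
  · change v k + (t : EReal) < b k
    rw [hvj, hj, EReal.bot_add]
    exact bot_lt_of_lt (hab k)

/-- An interval that contains a corner of the parameter square has a vertex on a diagonal which
misses a boundary. -/
theorem exists_dl_eq_top (h : IsSlab I l u) {z : Pt 2} (hz : z ∈ I)
    (hcorner : ∀ k, z k = ⊥ ∨ z k = ⊤) :
    ∃ v ∈ vertices I, dl v (lowerBoundary I) = ⊤ ∨ dl v (upperBoundary I) = ⊤ := by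
  obtain ⟨a, b, hab, haz, hzb, hsub⟩ := h.fat z hz
  have bot : ∀ k, z k = ⊥ → a k = ⊥ := fun k e => le_bot_iff.1 (e ▸ haz k)
  have top : ∀ k, z k = ⊤ → b k = ⊤ := fun k e => top_le_iff.1 (e ▸ hzb k)
  rcases hcorner 1 with e1 | e1
  · obtain ⟨v, hv, e⟩ := h.dl_eq_top_of_bot (i := 0) (j := 1) (by decide) (by decide) hab hsub
      (bot 1 e1) ((hcorner 0).imp (bot 0) (top 0))
    exact ⟨v, hv, Or.inr e⟩
  rcases hcorner 0 with e0 | e0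
  · obtain ⟨v, hv, e⟩ := h.dl_eq_top_of_bot (i := 1) (j := 0) (by decide) (by decide) hab hsub
      (bot 0 e0) (Or.inr (top 1 e1))
    exact ⟨v, hv, Or.inr e⟩
  -- The remaining corner has both coordinates `⊤`. It is itself a vertex, is fixed by all
  -- translations, and lies strictly above a point of `I`.
  have hb0 := top 0 e0
  have hb1 := top 1 e1
  have hle : a ≤ b := fun k => (hab k).le
  have hU : ∀ x ∈ I, x 1 = ⊤ → x ∈ upperBoundary I := fun x hx hxt =>
    ⟨subset_closure hx, fun y hy _ => not_top_lt (hxt ▸ hy 1)⟩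
  have hbU : b ∈ upperBoundary I ∧ b 1 = ⊤ := ⟨hU b (hsub ⟨hle, le_rfl⟩) hb1, hb1⟩
  have hgreat : IsGreatest {x | x ∈ upperBoundary I ∧ x 1 = ⊤} b :=
    ⟨hbU, fun x _ => le_pt_iff.2 ⟨hb0 ▸ le_top, hb1 ▸ le_top⟩⟩
  refine ⟨b, h.isCurve_upper.vertex_of_isGreatest hgreat (w := ![a 0, ⊤])
    ⟨hU _ (hsub ⟨le_pt_iff.2 ⟨le_rfl, le_top⟩, le_pt_iff.2 ⟨hle 0, hb1 ▸ le_rfl⟩⟩) rfl, rfl⟩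
    fun e => (hab 0).ne (congrFun e 0), Or.inl (iInf₂_eq_top.2 ?_)⟩
  rintro y ⟨⟨t, rfl⟩, hy⟩
  refine absurd (hsub ⟨le_rfl, hle⟩) (hy.2 a ?_)
  rw [Fin.forall_fin_two]
  constructor
  · change a 0 < b 0 + (t : EReal)
    rw [hb0, EReal.top_add_coe, ← hb0]
    exact hab 0
  · change a 1 < b 1 + (t : EReal)
    rw [hb1, EReal.top_add_coe, ← hb1]
    exact hab 1

/-- An interval that contains no corner of the parameter square has short diagonals. -/
theorem not_mem_translate (h : IsSlab I l u) {C δ : ℝ} (hI : IsTame I C) (hC : 0 ≤ C) (hδ : C < δ)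
    (hcorner : ∀ z ∈ I, ¬ ∀ k, z k = ⊥ ∨ z k = ⊤) (x : Pt 2) (hx : x ∈ I) :
    translate δ (translate δ x) ∉ I := by
  classical
  intro hx'
  rw [translate_translate] at hx'
  -- A point between `x` and its shift, with each coordinate below `-C` or above `C`; tameness then
  -- moves it to a corner of the square.
  let m : Pt 2 := fun k => if x k < ((-C : ℝ) : EReal) then x k else x k + ((δ + δ : ℝ) : EReal)
  have hle : ∀ k, x k ≤ x k + ((δ + δ : ℝ) : EReal) := fun k =>
    le_add_of_nonneg_right (EReal.coe_nonneg.2 (by linarith))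
  have hm : m ∈ I := by
    refine h.interval.convex x hx _ hx' m (fun k => ?_) (fun k => ?_)
    · by_cases hk : x k < ((-C : ℝ) : EReal)
      · exact (if_pos hk).ge
      · exact (hle k).trans_eq (if_neg hk).symm
    · by_cases hk : x k < ((-C : ℝ) : EReal)
      · exact (if_pos hk).trans_le (hle k)
      · exact (if_neg hk).le
  refine hcorner (fun k => if x k < ((-C : ℝ) : EReal) then ⊥ else ⊤) (hI m _ (fun k => ?_) hm)
    (fun k => ?_)
  · right
    by_cases hk : x k < ((-C : ℝ) : EReal)
    · right
      simp only [m, if_pos hk]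
      exact ⟨hk, EReal.bot_lt_coe _⟩
    · left
      simp only [m, if_neg hk]
      refine ⟨lt_of_lt_of_le ?_ (add_le_add (not_lt.1 hk) le_rfl), EReal.coe_lt_top _⟩
      rw [← EReal.coe_add, EReal.coe_lt_coe_iff]
      linarith
  · by_cases hk : x k < ((-C : ℝ) : EReal)
    · exact Or.inl (if_pos hk)
    · exact Or.inr (if_neg hk)

end IsSlab

theorem not_reach {n : ℕ} {I J : Set (Pt n)} {δ : ℝ}
    (hI : ∀ x ∈ I, translate δ (translate δ x) ∉ I)
    (hJ : ∀ x ∈ J, translate δ (translate δ x) ∉ J) (x : Pt n) : ¬ Reach I J δ x := by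
  intro hx
  induction hx with
  | source x hx hx' => exact hI x hx hx'
  | target x hx hx' => exact hJ x hx hx'
  | up _ _ _ _ _ _ ih => exact ih
  | down _ _ _ _ _ _ ih => exact ih

/-! ### The candidate set -/

theorem dl_self {n : ℕ} {A : Set (Pt n)} {x : Pt n} (hx : x ∈ A) : dl x A = 0 := by
  refine le_antisymm ?_ bot_le
  have : dl x A ≤ distInf x x := iInf₂_le x ⟨⟨0, (translate_zero x).symm⟩, hx⟩
  refine this.trans ?_
  simp [distInf]

theorem finite_candidateSet_and_ncard_le {I J : Set (Pt 2)} (hI : (vertices I).Finite)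
    (hJ : (vertices J).Finite) : (candidateSet I J).Finite ∧
    (candidateSet I J).ncard ≤ 8 * ((vertices I).ncard + (vertices J).ncard) := by
  classical
  let V : Finset (Pt 2) := (hI.union hJ).toFinset
  let E : Pt 2 → Finset ℝ≥0∞ := fun x => {dl x (lowerBoundary I), dl x (lowerBoundary J),
    dl x (upperBoundary I), dl x (upperBoundary J)}
  -- Each vertex contributes at most four distances and their four halves.
  let W : Finset ℝ≥0∞ := V.biUnion fun x => E x ∪ (E x).image fun d => d / 2
  have hsub : candidateSet I J ⊆ W := by
    rintro d ⟨x, hx, hd⟩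
    simp only [W, Finset.coe_biUnion, Set.mem_iUnion]
    refine ⟨x, by simpa [V] using hx, ?_⟩
    rw [Finset.mem_coe, Finset.mem_union]
    refine hd.imp (fun hd => by simpa [E, diagonalDistances] using hd) (fun hd => ?_)
    rw [Finset.mem_image]
    refine ⟨2 * d, by simpa [E, diagonalDistances] using hd, ?_⟩
    rw [mul_comm]
    exact ENNReal.mul_div_cancel_right two_ne_zero ENNReal.ofNat_ne_top
  refine ⟨W.finite_toSet.subset hsub, ?_⟩
  have h1 : (candidateSet I J).ncard ≤ W.card := by
    rw [← Set.ncard_coe_finset]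
    exact Set.ncard_le_ncard hsub W.finite_toSet
  have h2 : W.card ≤ V.card * 8 := Finset.card_biUnion_le_card_mul _ _ _ fun x _ => by
    have h4 : (E x).card ≤ 4 := Finset.card_le_four
    exact (Finset.card_union_le _ _).trans
      ((add_le_add h4 (Finset.card_image_le.trans h4)))
  have h3 : V.card ≤ (vertices I).ncard + (vertices J).ncard :=
    (Set.ncard_eq_toFinset_card _ (hI.union hJ)).symm.le.trans (Set.ncard_union_le _ _)
  linarith

theorem ofReal_mem_candidateSet {I J : Set (Pt 2)} {x : Pt 2} {c : ℝ}
    (hx : x ∈ vertices I ∪ vertices J) (h : ENNReal.ofReal c ∈ diagonalDistances I J x) :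
    ENNReal.ofReal c ∈ candidateSet I J := ⟨x, hx, Or.inl h⟩

theorem ofReal_half_mem_candidateSet {I J : Set (Pt 2)} {x : Pt 2} {c : ℝ}
    (hx : x ∈ vertices I ∪ vertices J) (h : ENNReal.ofReal c ∈ diagonalDistances I J x) :
    ENNReal.ofReal (c / 2) ∈ candidateSet I J := by
  refine ⟨x, hx, Or.inr ?_⟩
  have : 2 * ENNReal.ofReal (c / 2) = ENNReal.ofReal c := by
    rw [show (2 : ℝ≥0∞) = ENNReal.ofReal 2 by simp, ← ENNReal.ofReal_mul (by norm_num)]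
    congr 1
    ring
  rwa [this]

/-- Differences between the two intervals are excluded through the distances themselves, lengths of
bars in `[2δ, 2δ']` through their halves. -/
theorem isGeneric_of_candidateSet {I J : Set (Pt 2)} {l u l' u' : ℝ → EReal} (h : IsSlab I l u)
    (h' : IsSlab J l' u') {δ δ' : ℝ} (hδ : 0 < δ)
    (hS : ∀ c : ℝ, δ ≤ c → c ≤ δ' → ENNReal.ofReal c ∉ candidateSet I J) :
    IsGeneric l u l' u' δ δ' := by
  have mem : ∀ (c : ℝ), δ ≤ c → c ≤ δ' → ∀ x ∈ vertices I ∪ vertices J,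
      ENNReal.ofReal c ∉ diagonalDistances I J x := fun c h1 h2 x hx e =>
    hS c h1 h2 (ofReal_mem_candidateSet hx e)
  have mem2 : ∀ (c : ℝ), 2 * δ ≤ c → c ≤ 2 * δ' → ∀ x ∈ vertices I ∪ vertices J,
      ENNReal.ofReal c ∉ diagonalDistances I J x := fun c h1 h2 x hx e =>
    hS (c / 2) (by linarith) (by linarith) (ofReal_half_mem_candidateSet hx e)
  have sub : ∀ {x c}, ENNReal.ofReal c ∉ diagonalDistances I J x →
      (dl x (lowerBoundary I) ≠ ENNReal.ofReal c ∧ dl x (lowerBoundary J) ≠ ENNReal.ofReal c) ∧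
      (dl x (upperBoundary I) ≠ ENNReal.ofReal c ∧ dl x (upperBoundary J) ≠ ENNReal.ofReal c) := by
    intro x c hc
    simp only [diagonalDistances, Set.mem_insert_iff, Set.mem_singleton_iff, not_or] at hc
    exact ⟨⟨Ne.symm hc.1, Ne.symm hc.2.1⟩, Ne.symm hc.2.2.1, Ne.symm hc.2.2.2⟩
  have hL := h.isCurve_lower
  have hU := h.isCurve_upper
  have hL' := h'.isCurve_lower
  have hU' := h'.isCurve_upper
  have hcomm := Set.inter_comm {t | l' t ≤ u' t} {t | l t ≤ u t}
  exact
  { lower := fun t => ⟨h.lower_ne_top t, h'.lower_ne_top t⟩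
    upper := fun t => ⟨h.upper_ne_bot t, h'.upper_ne_bot t⟩
    dom := ⟨h.isClosed_le, h.ordConnected⟩
    dom' := ⟨h'.isClosed_le, h'.ordConnected⟩
    length := by
      rw [← Set.inter_self {t | l t ≤ u t}]
      refine hU.isRegular_sub hL (by linarith) fun c h1 h2 x hx => ?_
      have := sub (mem2 c h1 h2 x (Or.inl (by simpa using hx)))
      exact ⟨this.2.1, this.1.1⟩
    length' := by
      rw [← Set.inter_self {t | l' t ≤ u' t}]
      refine hU'.isRegular_sub hL' (by linarith) fun c h1 h2 x hx => ?_
      have := sub (mem2 c h1 h2 x (Or.inr (by simpa using hx)))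
      exact ⟨this.2.2, this.1.2⟩
    lowers := hcomm ▸ hL'.isRegular_sub hL hδ fun c h1 h2 x hx =>
      have := sub (mem c h1 h2 x hx.symm)
      ⟨this.1.2, this.1.1⟩
    lowers' := hL.isRegular_sub hL' hδ fun c h1 h2 x hx =>
      have := sub (mem c h1 h2 x hx)
      ⟨this.1.1, this.1.2⟩
    uppers := hcomm ▸ hU'.isRegular_sub hU hδ fun c h1 h2 x hx =>
      have := sub (mem c h1 h2 x hx.symm)
      ⟨this.2.2, this.2.1⟩
    uppers' := hU.isRegular_sub hU' hδ fun c h1 h2 x hx =>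
      have := sub (mem c h1 h2 x hx)
      ⟨this.2.1, this.2.2⟩
    mixed := hcomm ▸ hU'.isRegular_sub hL hδ fun c h1 h2 x hx =>
      have := sub (mem c h1 h2 x hx.symm)
      ⟨this.2.2, this.1.1⟩
    mixed' := hU.isRegular_sub hL' hδ fun c h1 h2 x hx =>
      have := sub (mem c h1 h2 x hx)
      ⟨this.2.1, this.1.2⟩ }

theorem exists_gap {S : Set ℝ≥0∞} (hS : S.Finite) {d : ℝ} (hd : 0 < d)
    (hdS : ENNReal.ofReal d ∉ S) :
    ∃ ε > 0, ε < d ∧ ∀ c : ℝ, d - ε ≤ c → c ≤ d + ε → ENNReal.ofReal c ∉ S := by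
  have : ∀ᶠ c in 𝓝 d, ENNReal.ofReal c ∉ S :=
    ENNReal.continuous_ofReal.continuousAt.eventually (hS.isClosed.isOpen_compl.mem_nhds hdS)
  obtain ⟨η, hη, hball⟩ := Metric.eventually_nhds_iff.1 this
  refine ⟨min (η / 2) (d / 2), by positivity, (min_le_right _ _).trans_lt (by linarith),
    fun c h1 h2 => hball ?_⟩
  have := min_le_left (η / 2) (d / 2)
  rw [Real.dist_eq, abs_lt]
  constructor <;> linarith

variable (K : Type u) [Field K]

theorem finite_candidateSet_and_interleavingDistance_mem {I J : Set (Pt 2)}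
    (hI : IsDiscretelyPresented I) (hJ : IsDiscretelyPresented J) :
    (candidateSet I J).Finite ∧
    (candidateSet I J).ncard ≤ 8 * ((vertices I).ncard + (vertices J).ncard) ∧
    interleavingDistance (intervalModule K I hI.isInterval) (intervalModule K J hJ.isInterval) ∈
      candidateSet I J := by
  obtain ⟨R, hR, hIR⟩ := hI.finite_union
  obtain ⟨R', hR', hJR⟩ := hJ.finite_union
  obtain ⟨l, u, h⟩ := exists_isSlab hI.isInterval R hR hIR
  obtain ⟨l', u', h'⟩ := exists_isSlab hJ.isInterval R' hR' hJR
  obtain ⟨C₁, hC₁, hIC⟩ := exists_isTame R hR hIR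
  obtain ⟨C₂, hC₂, hJC⟩ := exists_isTame R' hR' hJR
  replace hIC := isTame_mono hIC (le_max_left C₁ C₂)
  replace hJC := isTame_mono hJC (le_max_right C₁ C₂)
  set C := max C₁ C₂
  have hC : 0 ≤ C := hC₁.trans (le_max_left _ _)
  obtain ⟨hfin, hcard⟩ := finite_candidateSet_and_ncard_le (finite_vertices h R hIR)
    (finite_vertices h' R' hJR)
  refine ⟨hfin, hcard, ?_⟩
  by_contra hd
  have le_of : ∀ δ : ℝ≥0, Interleaved (intervalModule K I hI.isInterval)
      (intervalModule K J hJ.isInterval) δ → interleavingDistance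
      (intervalModule K I hI.isInterval) (intervalModule K J hJ.isInterval) ≤ δ :=
    fun δ hδ => iInf₂_le δ hδ
  have lt_of : ∀ x : ℝ≥0∞, interleavingDistance (intervalModule K I hI.isInterval)
      (intervalModule K J hJ.isInterval) < x → ∃ δ : ℝ≥0, Interleaved
      (intervalModule K I hI.isInterval) (intervalModule K J hJ.isInterval) δ ∧ (δ : ℝ≥0∞) < x := by
    intro x hx
    obtain ⟨δ, hδ⟩ := iInf_lt_iff.1 hx
    obtain ⟨hδ1, hδ2⟩ := iInf_lt_iff.1 hδ
    exact ⟨δ, hδ1, hδ2⟩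
  set d := interleavingDistance (intervalModule K I hI.isInterval)
    (intervalModule K J hJ.isInterval)
  have hzero : d ≠ 0 := by
    rintro e
    obtain ⟨v, hv, hvL⟩ := h.exists_vertex_mem_lowerBoundary
    exact hd (e ▸ ⟨v, Or.inl hv, Or.inl (Or.inl (dl_self hvL).symm)⟩)
  have htop : d ≠ ⊤ := by
    rintro e
    have hcI : ∀ z ∈ I, ¬ ∀ k, z k = ⊥ ∨ z k = ⊤ := by
      intro z hz hcorner
      obtain ⟨v, hv, hv'⟩ := h.exists_dl_eq_top hz hcorner
      refine hd (e ▸ ⟨v, Or.inl hv, Or.inl ?_⟩)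
      simp only [diagonalDistances, Set.mem_insert_iff, Set.mem_singleton_iff]
      exact hv'.elim (fun e => Or.inl e.symm) (fun e => Or.inr (Or.inr (Or.inl e.symm)))
    have hcJ : ∀ z ∈ J, ¬ ∀ k, z k = ⊥ ∨ z k = ⊤ := by
      intro z hz hcorner
      obtain ⟨v, hv, hv'⟩ := h'.exists_dl_eq_top hz hcorner
      refine hd (e ▸ ⟨v, Or.inr hv, Or.inl ?_⟩)
      simp only [diagonalDistances, Set.mem_insert_iff, Set.mem_singleton_iff]
      exact hv'.elim (fun e => Or.inr (Or.inl e.symm)) (fun e => Or.inr (Or.inr (Or.inr e.symm)))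
    -- For a parameter larger than `C` no interval contains a point together with its double shift,
    -- so nothing is forced and the zero maps interleave.
    have nI := h.not_mem_translate (δ := C + 1) hIC hC (by linarith) hcI
    have nJ := h'.not_mem_translate (δ := C + 1) hJC hC (by linarith) hcJ
    have hint := interleaved_of_reach K hI.isInterval hJ.isInterval ⟨C + 1, by positivity⟩
      (fun x hx => absurd hx (not_reach nI nJ x)) (fun x hx => absurd hx (not_reach nJ nI x))
    exact ENNReal.coe_ne_top (top_le_iff.1 (e ▸ le_of _ hint))
  have hreal : ENNReal.ofReal d.toReal = d := ENNReal.ofReal_toReal htop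
  obtain ⟨ε, hε, hεd, hgap⟩ := exists_gap hfin (ENNReal.toReal_pos hzero htop) (hreal.symm ▸ hd)
  obtain ⟨δ, hδ⟩ : ∃ δ : ℝ≥0, (δ : ℝ) = d.toReal - ε := ⟨⟨_, (sub_pos.2 hεd).le⟩, rfl⟩
  -- At `δ = d - ε`, below the infimum, there is no interleaving.
  have hobs : Obstructed l u l' u' δ := by
    by_contra hobs
    have hle := le_of δ (interleaved_of_not_obstructed K h h' hIC hJC hobs)
    have := ENNReal.toReal_mono ENNReal.coe_ne_top hle
    rw [ENNReal.coe_toReal] at this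
    linarith
  obtain ⟨δ', hint, hδ'⟩ := lt_of (ENNReal.ofReal (d.toReal + ε)) (by
    nth_rw 1 [← hreal]
    exact (ENNReal.ofReal_lt_ofReal_iff (by positivity)).2 (by linarith))
  have hlt : (δ' : ℝ) < d.toReal + ε := by
    rw [← ENNReal.ofReal_coe_nnreal] at hδ'
    exact (ENNReal.ofReal_lt_ofReal_iff (by positivity)).1 hδ'
  have hgen : IsGeneric l u l' u' (δ : ℝ) (d.toReal + ε) :=
    isGeneric_of_candidateSet h h' (by rw [hδ]; linarith) (by rw [hδ]; exact hgap)
  exact hint.not_obstructed h h' hlt (hgen.obstructed (NNReal.coe_nonneg δ) hobs)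

end BiPersistence

end

theorem mainTheorem2 {K : Type u} [Field K] (I J : Set (BiPersistence.Pt 2))
    (hI : BiPersistence.IsDiscretelyPresented I) (hJ : BiPersistence.IsDiscretelyPresented J) :
    (BiPersistence.candidateSet I J).Finite ∧
    (BiPersistence.candidateSet I J).ncard ≤
      8 * ((BiPersistence.vertices I).ncard + (BiPersistence.vertices J).ncard) ∧
    BiPersistence.interleavingDistance
        (BiPersistence.intervalModule K I hI.isInterval)
        (BiPersistence.intervalModule K J hJ.isInterval) ∈
      BiPersistence.candidateSet I J :=
  BiPersistence.finite_candidateSet_and_interleavingDistance_mem K hI hJ
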